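/- **Definitions.** A *curve* is a differentiable $f:[a,b]\to\mathbb C$, $a<b$, whose derivative is absolutely continuous and non-zero; $\kappa$ denotes its signed curvature and $s$ its arc length. Its *turning angle* is $\int\kappa\,ds$ and its *bending energy* is $\|f\|^2=\frac14\int\kappa^2\,ds\in[0,\infty]$. A *c-curve* is a curve with $\kappa\ge 0$ a.e. (left) or $\kappa\le 0$ a.e. (right) whose turning angle has magnitude at most $\pi$. An *s-curve* is a c-curve, or a curve consisting of two consecutive c-curves which turn in opposite directions. A *unit tangent vector* is a pair $u=(u_1,u_2)\in\mathbb C^2$ with $|u_2|=1$ (position $u_1$, direction $u_2$). $S(u,v)$ is the set of s-curves whose initial and terminal unit tangent vectors are $u$ and $v$. Two curves are equivalent if they have the same arc length parametrization; $f$ is *similar* to $g$ if $f$ is equivalent to $T\circ g$ for some $T(z)=c_1z+c_2$ or $T(z)=c_1\bar z+c_2$, $c_1\ne0$, and *directly similar* if $T$ can be taken of the first kind. The rectangular elastica is $E(t)=\sin t+i\,\xi(t)$, where $\xi(t)=\int_0^t\frac{\sin^2 r}{\sqrt{1+\sin^2 r}}\,dr$; $E_{[a,b]}$ is its restriction to $[a,b]$,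 and $\sqcup$ denotes concatenation of curves. A curve is of *first form* if it is directly similar to $E_{[t_0,t]}$ for some $-\pi<t_0<t<\pi$, and of *second form* if it is directly similar to $E_{[-\pi,0]}\sqcup[0,c]\sqcup(c+E_{[0,t]})$ for some $c\ge0$, $t\in[0,\pi]$. *Optimal* in $S(u,v)$ means: belonging to $S(u,v)$, of finite bending energy, and with $\|f\|^2\le\|g\|^2$ for all $g\in S(u,v)$. **Theorem.** (1) Let $u,v$ be unit tangent vectors with distinct positions. If $S(u,v)$ is non-empty, then it contains an optimal curve $f$ such that $f$ is similar to the line segment $[0,1]$, or $f$ is similar to $E_{[t_0,t]}$ for some $-\pi<t_0<t<\pi$, or $f$ or its reversal is similar to $E_{[-\pi,0]}\sqcup[0,c]\sqcup(c+E_{[0,t]})$ for some $c\ge 0$, $t\in[0,\pi]$. (2) Let $u=(0,e^{i\alpha})$ and $v=(1,e^{i\beta})$ with $\alpha\in[0,\pi]$ and $|\beta|\le\alpha$ (every pair with distinct positions is brought to this position by a similarity transformation and, possibly, a reversal of direction). Then $S(u,v)$ is non-empty if and only if $\alpha<\pi$ and $\beta\ge\alpha-\pi$. If $\alpha=0$,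 then the line segment $[0,1]$ is optimal, with bending energy $0$. Now let $0<\alpha<\pi$ and $\beta\ge\alpha-\pi$. Put $\Gamma=[\alpha-\pi,\beta]$ if $\beta<0$ and $\Gamma=[\alpha-\pi,0)$ if $\beta\ge0$, and for $\gamma\in\Gamma$ put $$y_1=\tfrac12\int_0^{\alpha-\gamma}\sqrt{\sin\tau}\,d\tau,\quad y_2=\tfrac12\int_0^{\beta-\gamma}\sqrt{\sin\tau}\,d\tau,\quad G(\gamma)=\frac{(y_1+y_2)^2}{-\sin\gamma},$$ $$\sigma(\gamma)=\cos\gamma+\frac{\sin\gamma}{y_1+y_2}\Bigl(\sqrt{\sin(\alpha-\gamma)}+\sqrt{\sin(\beta-\gamma)}\Bigr).$$ (2a) If $\beta\ge0$, or $\beta<0$ and $\sigma(\beta)\ge0$, then $G$ attains a minimum on $\Gamma$, and for every $\gamma\in\Gamma$ at which $G$ is minimal there is an optimal curve in $S(u,v)$ with bending energy $G(\gamma)$, which is of second form if $\gamma=\alpha-\pi$ and of first form if $\gamma>\alpha-\pi$. In particular the minimum bending energy in $S(u,v)$ is $\min_\Gamma G$. (2b) If $\alpha-\pi<\beta<0$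 and $\sigma(\beta)\le0$, then some optimal curve in $S(u,v)$ is a c-curve directly similar to $E_{[t_1,t_2]}$ with $-\pi<t_1<t_2\le0$ (hence of first form). -/

import Mathlib

open Set MeasureTheory
open scoped Real ENNReal ComplexConjugate

noncomputable section

namespace ElasticSpline

/-! ### Curves -/

/-- A parametrized path in the plane: a function restricted to `[left, right]`. Only the values of
`toFun` on that interval matter. -/
structure PlanePath where
  left : ℝ
  right : ℝ
  toFun : ℝ → ℂ

/-- The derivative of a path on `[left, right]` (one-sided at the end points). -/
def PlanePath.vel (p : PlanePath) (t : ℝ) : ℂ := derivWithin p.toFun (Icc p.left p.right) t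

/-- A curve: a differentiable path on a nondegenerate compact interval, whose derivative is
absolutely continuous and nowhere zero. It need not have unit speed. -/
structure IsCurve (p : PlanePath) : Prop where
  lt : p.left < p.right
  diff : DifferentiableOn ℝ p.toFun (Icc p.left p.right)
  ac : AbsolutelyContinuousOnInterval p.vel p.left p.right
  ne : ∀ t ∈ Icc p.left p.right, p.vel t ≠ 0

/-- Arc length from the initial point to the parameter value `t`. -/
def PlanePath.arcLength (p : PlanePath) (t : ℝ) : ℝ := ∫ r in p.left..t, ‖p.vel r‖

/-- Signed curvature `Im (conj f' * f'') / |f'|³` with respect to an arbitrary parametrization. If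
`f' = |f'| e^{iτ}` with `τ` absolutely continuous, this is `τ' / |f'| = dτ/ds` almost everywhere, the
derivative of the direction angle with respect to arc length. -/
def PlanePath.curvature (p : PlanePath) (t : ℝ) : ℝ :=
  (conj (p.vel t) * derivWithin p.vel (Icc p.left p.right) t).im / ‖p.vel t‖ ^ 3

/-- Turning angle `∫ κ ds` of the part of the curve over `[a, b]`. -/
def PlanePath.turning (p : PlanePath) (a b : ℝ) : ℝ := ∫ t in a..b, p.curvature t * ‖p.vel t‖

/-- Bending energy `(1/4) ∫ κ² ds`, with value `∞` if the curvature is not square integrable. -/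
def PlanePath.energy (p : PlanePath) : ℝ≥0∞ :=
  (1 / 4) * ∫⁻ t in Icc p.left p.right, ENNReal.ofReal (p.curvature t ^ 2 * ‖p.vel t‖)

/-- The part of `p` over `[a, b]` is a left c-curve: its signed curvature is nonnegative almost
everywhere and its turning angle is at most `π`. -/
def PlanePath.IsLeftCOn (p : PlanePath) (a b : ℝ) : Prop :=
  (∀ᵐ t ∂(volume.restrict (Icc a b)), 0 ≤ p.curvature t) ∧ p.turning a b ≤ π

/-- The part of `p` over `[a, b]` is a right c-curve: its signed curvature is nonpositive almost
everywhere and its turning angle has magnitude at most `π`. -/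
def PlanePath.IsRightCOn (p : PlanePath) (a b : ℝ) : Prop :=
  (∀ᵐ t ∂(volume.restrict (Icc a b)), p.curvature t ≤ 0) ∧ -π ≤ p.turning a b

/-- A c-curve: a left or right curve whose turning angle has magnitude at most `π`. -/
def IsCCurve (p : PlanePath) : Prop :=
  IsCurve p ∧ (p.IsLeftCOn p.left p.right ∨ p.IsRightCOn p.left p.right)

/-- An s-curve: either a c-curve, or a curve that some intermediate point divides into two c-curves
which turn in opposite directions. -/
def IsSCurve (p : PlanePath) : Prop :=
  IsCCurve p ∨ (IsCurve p ∧ ∃ m ∈ Ioo p.left p.right,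
    (p.IsLeftCOn p.left m ∧ p.IsRightCOn m p.right) ∨
    (p.IsRightCOn p.left m ∧ p.IsLeftCOn m p.right))

/-! ### Unit tangent vectors -/

/-- A unit tangent vector: a base point and a direction of modulus one. -/
structure UnitTangent where
  pos : ℂ
  dir : ℂ
  norm_dir : ‖dir‖ = 1

/-- The unit tangent vector with base point `z` and direction `e^{iθ}`. -/
def UnitTangent.ofAngle (z : ℂ) (θ : ℝ) : UnitTangent where
  pos := z
  dir := Complex.exp (θ * Complex.I)
  norm_dir := Complex.norm_exp_ofReal_mul_I θ

/-- `u` is the unit tangent vector to `p` at the parameter value `t`. -/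
def PlanePath.IsTangentAt (p : PlanePath) (t : ℝ) (u : UnitTangent) : Prop :=
  p.toFun t = u.pos ∧ p.vel t / (‖p.vel t‖ : ℂ) = u.dir

/-- The set `S(u, v)` of all s-curves which connect `u` to `v`. -/
def sCurves (u v : UnitTangent) : Set PlanePath :=
  {p | IsSCurve p ∧ p.IsTangentAt p.left u ∧ p.IsTangentAt p.right v}

/-- `p` belongs to `S` and has finite bending energy, minimal among all elements of `S`. -/
def IsOptimal (S : Set PlanePath) (p : PlanePath) : Prop :=
  p ∈ S ∧ p.energy ≠ ∞ ∧ ∀ q ∈ S, p.energy ≤ q.energy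

/-! ### Equivalence and similarity -/

/-- Two curves are equivalent if they describe the same unit speed curve: they have the same length,
and points at equal arc length from the initial point coincide. -/
def PlanePath.Equivalent (p q : PlanePath) : Prop :=
  p.arcLength p.right = q.arcLength q.right ∧
  ∀ s ∈ Icc p.left p.right, ∀ t ∈ Icc q.left q.right,
    p.arcLength s = q.arcLength t → p.toFun s = q.toFun t

/-- The image `T ∘ p`. -/
def PlanePath.map (T : ℂ → ℂ) (p : PlanePath) : PlanePath := ⟨p.left, p.right, fun t => T (p.toFun t)⟩

/-- The path traversed in the opposite direction. -/
def PlanePath.reverse (p : PlanePath) : PlanePath := ⟨-p.right, -p.left, fun t => p.toFun (-t)⟩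

/-- `p` is equivalent to `T ∘ q` for an orientation preserving similarity transformation `T`. -/
def PlanePath.DirectlySimilar (p q : PlanePath) : Prop :=
  ∃ c₁ c₂ : ℂ, c₁ ≠ 0 ∧ p.Equivalent (q.map fun z => c₁ * z + c₂)

/-- `p` is equivalent to `T ∘ q` for a similarity transformation `T` of either orientation. -/
def PlanePath.Similar (p q : PlanePath) : Prop :=
  ∃ c₁ c₂ : ℂ, c₁ ≠ 0 ∧
    (p.Equivalent (q.map fun z => c₁ * z + c₂) ∨ p.Equivalent (q.map fun z => c₁ * conj z + c₂))

/-! ### Rectangular elastica -/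

/-- `ξ(t) = ∫₀ᵗ sin² / √(1 + sin²)`. -/
def xi (t : ℝ) : ℝ := ∫ r in (0 : ℝ)..t, Real.sin r ^ 2 / √(1 + Real.sin r ^ 2)

/-- The rectangular elastica `E(t) = sin t + i ξ(t)`. -/
def elastica (t : ℝ) : ℂ := (Real.sin t : ℂ) + (xi t : ℂ) * Complex.I

/-- The segment `E_[a,b]`. -/
def elasticaSegment (a b : ℝ) : PlanePath := ⟨a, b, elastica⟩

/-- The line segment from `0` to `1`. -/
def unitSegment : PlanePath := ⟨0, 1, fun t => (t : ℂ)⟩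

/-- The concatenation `E_[-π,0] ⊔ [0,c] ⊔ (c + E_[0,t])`, parametrized over `[-π, c + t]`: first the
elastica u-turn ending at `0` with direction `1`, then the line segment from `0` to `c` at unit speed,
then the translate by `c` of the elastica segment `E_[0,t]`. -/
def uturnPath (c t : ℝ) : PlanePath where
  left := -π
  right := c + t
  toFun s := if s ≤ 0 then elastica s else if s ≤ c then (s : ℂ) else (c : ℂ) + elastica (s - c)

/-- Curves of first form. -/
def IsFirstForm (p : PlanePath) : Prop :=
  ∃ t₀ t : ℝ, -π < t₀ ∧ t₀ < t ∧ t < π ∧ p.DirectlySimilar (elasticaSegment t₀ t)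

/-- Curves of second form. -/
def IsSecondForm (p : PlanePath) : Prop :=
  ∃ c t : ℝ, 0 ≤ c ∧ t ∈ Icc 0 π ∧ p.DirectlySimilar (uturnPath c t)

/-! ### The function `G` -/

/-- `(1/2) ∫₀ˣ √(sin τ) dτ`. -/
def halfIntegral (x : ℝ) : ℝ := (1 / 2) * ∫ τ in (0 : ℝ)..x, √(Real.sin τ)

/-- The set of possible inflection angles. -/
def Gam (α β : ℝ) : Set ℝ := if β < 0 then Icc (α - π) β else Ico (α - π) 0

/-- `y₁ + y₂`, where `y₁ = (1/2) ∫₀^{α-γ} √(sin τ) dτ` and `y₂ = (1/2) ∫₀^{β-γ} √(sin τ) dτ`. -/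
def ySum (α β γ : ℝ) : ℝ := halfIntegral (α - γ) + halfIntegral (β - γ)

/-- `G(γ) = (y₁ + y₂)² / (-sin γ)`. -/
def G (α β γ : ℝ) : ℝ := ySum α β γ ^ 2 / (-Real.sin γ)

/-- `σ(γ) = cos γ + sin γ / (y₁ + y₂) * (√sin (α - γ) + √sin (β - γ))`. -/
def sigma (α β γ : ℝ) : ℝ :=
  Real.cos γ + Real.sin γ / ySum α β γ * (√(Real.sin (α - γ)) + √(Real.sin (β - γ)))

end ElasticSpline

end

open ElasticSpline

namespace ElasticSpline

/-! ### Absolutely continuous functions -/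

/-! Write H for `halfIntegral` and let θ be a continuous direction angle along an s-curve from 0 to
1. Suppose all directions lie in a half circle [γ, γ + π]. Then ∫ sin (θ - γ) ds is the height of
the chord above the direction γ, that is -sin γ, while √sin (θ - γ) κ ds is the differential of 2
H(θ - γ). Expanding (κ ± μ √sin (θ - γ))² ≥ 0, with the sign switching at a chosen point m, and
optimizing μ bounds the energy below by (H(θ left - γ) + H(θ right - γ) - 2 H(θ m - γ))² / (-sin γ);
this is `PlanePath.IsLift.ofReal_le_energy`. Equality means that κ² is proportional to sin (θ - γ),
which is the equation of the rectangular elastica: there κ = 2 sin t and the sine of the direction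
angle is sin² t.

For an s-curve that turns right and then left, take γ to be the angle at the inflection m: the bound
is G(γ). Curves that turn left and then right occur only for β < 0 and cost at least G(β). Hence the
infimum of G bounds all energies (`exists_G_le_energy`). To attain G(γ), cut E at the directions α -
γ and β - γ. The chord has the required slope after a horizontal segment of length (y₁ + y₂) σ(γ) /
(-sin γ), which costs no energy, is inserted at the inflection. Since σ has the sign of G', at a
minimizer either σ = 0 and nothing is inserted, or γ = α - π, σ ≥ 0, and the arc starts with a full
u-turn.

If β < 0 and σ(β) ≤ 0, the first order argument can fail at the end point β. Instead the bound
without a sign change, (H(α - γ) - H(β - γ))² / (-sin γ), is used in the frame γ in which the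
corresponding c-curve piece of E fits the chord (`exists_critical`). It applies to every s-curve
with directions in [γ, γ + π]; s-curves which leave this half circle are more expensive by a
monotonicity argument (`critical_le`).

Arbitrary pairs of tangent vectors are brought to normalized position by similarities, reflection
and reversal, all of which multiply the energy by a constant. -/

theorem absolutelyContinuousOnInterval_of_dist_le {X Y : Type*} [PseudoMetricSpace X]
    [PseudoMetricSpace Y] {f : ℝ → X} {g : ℝ → Y} {a b K : ℝ}
    (hf : AbsolutelyContinuousOnInterval f a b)
    (h : ∀ x ∈ uIcc a b, ∀ y ∈ uIcc a b, dist (g x) (g y) ≤ K * dist (f x) (f y)) :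
    AbsolutelyContinuousOnInterval g a b := by
  unfold AbsolutelyContinuousOnInterval at hf ⊢
  have hf' := hf.const_mul K
  rw [mul_zero] at hf'
  refine squeeze_zero' (Filter.Eventually.of_forall fun E => Finset.sum_nonneg fun i _ => dist_nonneg)
    ?_ hf'
  filter_upwards [Filter.mem_inf_of_right (Filter.mem_principal_self _)] with E hE
  rw [Finset.mul_sum]
  exact Finset.sum_le_sum fun i hi => h _ (hE.1 i hi).1 _ (hE.1 i hi).2

theorem absolutelyContinuousOnInterval_integral {E : Type*} [NormedAddCommGroup E] [NormedSpace ℝ E]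
    {f : ℝ → E} {a b : ℝ} (hf : IntervalIntegrable f volume a b) :
    AbsolutelyContinuousOnInterval (fun x => ∫ t in a..x, f t) a b := by
  refine absolutelyContinuousOnInterval_of_dist_le (K := 1)
    (hf.norm.absolutelyContinuousOnInterval_intervalIntegral (c := a) left_mem_uIcc) ?_
  intro x hx y hy
  have hi : ∀ z ∈ uIcc a b, IntervalIntegrable f volume a z := fun z hz =>
    hf.mono_set (uIcc_subset_uIcc left_mem_uIcc hz)
  rw [one_mul, dist_eq_norm, dist_eq_norm, intervalIntegral.integral_interval_sub_left (hi x hx) (hi y hy),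
    intervalIntegral.integral_interval_sub_left (hi x hx).norm (hi y hy).norm]
  exact intervalIntegral.norm_integral_le_abs_integral_norm

theorem absolutelyContinuousOnInterval_cexp {A : ℝ → ℂ} {a b : ℝ}
    (hA : AbsolutelyContinuousOnInterval A a b) :
    AbsolutelyContinuousOnInterval (fun t => Complex.exp (A t)) a b := by
  obtain ⟨C, hC⟩ := hA.exists_bound
  refine absolutelyContinuousOnInterval_of_dist_le (K := Real.exp C) hA ?_
  intro x hx y hy
  have := (convex_closedBall (0 : ℂ) C).norm_image_sub_le_of_norm_deriv_le (𝕜 := ℂ)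
    (f := Complex.exp) (C := Real.exp C) (fun z _ => Complex.differentiableAt_exp)
    (fun z hz => by
      rw [Complex.deriv_exp, Complex.norm_exp]
      exact Real.exp_le_exp.2 ((Complex.re_le_norm z).trans (by simpa using hz)))
    (x := A y) (y := A x) (by simpa using hC y hy) (by simpa using hC x hx)
  simpa [dist_eq_norm] using this

/-- Real and imaginary parts are compositions with 1-Lipschitz maps, so the real-valued theorem
applies to each of them. -/
theorem ae_hasDerivAt_of_absolutelyContinuousOnInterval {f : ℝ → ℂ} {a b : ℝ}
    (hf : AbsolutelyContinuousOnInterval f a b) :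
    (∀ᵐ t, t ∈ uIcc a b → HasDerivAt f (deriv f t) t) ∧
      IntervalIntegrable (deriv f) volume a b := by
  have hre : AbsolutelyContinuousOnInterval (fun t => (f t).re) a b :=
    absolutelyContinuousOnInterval_of_dist_le (K := 1) hf fun x _ y _ => by
      rw [one_mul, Real.dist_eq, ← Complex.sub_re, dist_eq_norm]; exact Complex.abs_re_le_norm _
  have him : AbsolutelyContinuousOnInterval (fun t => (f t).im) a b :=
    absolutelyContinuousOnInterval_of_dist_le (K := 1) hf fun x _ y _ => by
      rw [one_mul, Real.dist_eq, ← Complex.sub_im, dist_eq_norm]; exact Complex.abs_im_le_norm _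
  have key : ∀ᵐ t, t ∈ uIcc a b → HasDerivAt f
      (((deriv (fun t => (f t).re) t : ℝ) : ℂ) + ((deriv (fun t => (f t).im) t : ℝ) : ℂ) * Complex.I) t := by
    filter_upwards [hre.ae_differentiableAt, him.ae_differentiableAt] with t h1 h2 ht
    have := (h1 ht).hasDerivAt.ofReal_comp.add ((h2 ht).hasDerivAt.ofReal_comp.mul_const Complex.I)
    refine this.congr_of_eventuallyEq (Filter.Eventually.of_forall fun s => ?_)
    simp
  refine ⟨?_, ?_⟩
  · filter_upwards [key] with t h ht
    exact (h ht).differentiableAt.hasDerivAt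
  · have ofReal' : ∀ g : ℝ → ℝ, IntervalIntegrable g volume a b →
        IntervalIntegrable (fun t => (g t : ℂ)) volume a b := fun g hg => by
      rw [intervalIntegrable_iff] at hg ⊢
      exact hg.ofReal
    have h1 := (ofReal' _ hre.intervalIntegrable_deriv).add
      ((ofReal' _ him.intervalIntegrable_deriv).mul_const Complex.I)
    refine h1.congr_ae ?_
    rw [Filter.EventuallyEq, ae_restrict_iff' measurableSet_uIoc]
    filter_upwards [key] with t h ht
    exact (h (uIoc_subset_uIcc ht)).deriv.symm

/-! ### The direction angle of a curve -/

namespace IsCurve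

variable {p : PlanePath}

theorem continuousOn_vel (hp : IsCurve p) : ContinuousOn p.vel (Icc p.left p.right) := by
  have := hp.ac.continuousOn
  rwa [uIcc_of_le hp.lt.le] at this

theorem ae_hasDerivAt_vel (hp : IsCurve p) : ∀ᵐ t, t ∈ Icc p.left p.right →
    HasDerivAt p.vel (derivWithin p.vel (Icc p.left p.right) t) t ∧
      derivWithin p.vel (Icc p.left p.right) t = deriv p.vel t := by
  have h := (ae_hasDerivAt_of_absolutelyContinuousOnInterval hp.ac).1
  rw [uIcc_of_le hp.lt.le] at h
  have h1 : ∀ᵐ t : ℝ, t ≠ p.left := by simp [ae_iff, measure_singleton]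
  have h2 : ∀ᵐ t : ℝ, t ≠ p.right := by simp [ae_iff, measure_singleton]
  filter_upwards [h, h1, h2] with t h h1 h2 ht
  have hd : derivWithin p.vel (Icc p.left p.right) t = deriv p.vel t :=
    derivWithin_of_mem_nhds (Icc_mem_nhds (lt_of_le_of_ne ht.1 h1.symm) (lt_of_le_of_ne ht.2 h2))
  rw [hd]
  exact ⟨h ht, rfl⟩

theorem intervalIntegrable_logDeriv (hp : IsCurve p) :
    IntervalIntegrable (fun t => derivWithin p.vel (Icc p.left p.right) t / p.vel t) volume
      p.left p.right := by
  have h1 := (ae_hasDerivAt_of_absolutelyContinuousOnInterval hp.ac).2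
  have h2 : IntervalIntegrable (derivWithin p.vel (Icc p.left p.right)) volume p.left p.right := by
    refine h1.congr_ae ?_
    rw [Filter.EventuallyEq, ae_restrict_iff' measurableSet_uIoc]
    filter_upwards [hp.ae_hasDerivAt_vel] with t h ht
    rw [uIoc_of_le hp.lt.le] at ht
    exact (h (Ioc_subset_Icc_self ht)).2.symm
  have h3 : ContinuousOn (fun t => (p.vel t)⁻¹) (uIcc p.left p.right) := by
    rw [uIcc_of_le hp.lt.le]
    exact hp.continuousOn_vel.inv₀ hp.ne
  simpa [div_eq_mul_inv] using h2.mul_continuousOn h3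

theorem curvature_mul_norm (p : PlanePath) (t : ℝ) : p.curvature t * ‖p.vel t‖ =
    (derivWithin p.vel (Icc p.left p.right) t / p.vel t).im := by
  unfold PlanePath.curvature
  by_cases h : p.vel t = 0
  · simp [h]
  · have h' : ‖p.vel t‖ ≠ 0 := norm_ne_zero_iff.2 h
    rw [div_eq_mul_inv (derivWithin _ _ _), Complex.inv_def, ← mul_assoc, Complex.im_mul_ofReal,
      mul_comm (conj _), Complex.normSq_eq_norm_sq]
    field_simp

theorem intervalIntegrable_curvature (hp : IsCurve p) :
    IntervalIntegrable (fun t => p.curvature t * ‖p.vel t‖) volume p.left p.right := by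
  simp_rw [curvature_mul_norm]
  have h := hp.intervalIntegrable_logDeriv
  rw [intervalIntegrable_iff] at h ⊢
  exact h.im

/-- The product of the velocity with exp (-∫ vel' / vel) is absolutely continuous with derivative
zero almost everywhere, hence constant. This gives a logarithm of the velocity without choosing a
branch. -/
theorem vel_eq_mul_exp (hp : IsCurve p) {t : ℝ} (ht : t ∈ Icc p.left p.right) :
    p.vel t = p.vel p.left * Complex.exp
      (∫ s in p.left..t, derivWithin p.vel (Icc p.left p.right) s / p.vel s) := by
  set f : ℝ → ℂ := fun s => derivWithin p.vel (Icc p.left p.right) s / p.vel s with hf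
  have hint := hp.intervalIntegrable_logDeriv
  set A : ℝ → ℂ := fun x => ∫ s in p.left..x, f s with hA
  have hAac : AbsolutelyContinuousOnInterval A p.left p.right :=
    absolutelyContinuousOnInterval_integral hint
  have hac := hp.ac.fun_smul (absolutelyContinuousOnInterval_cexp hAac.neg)
  obtain ⟨C, hC⟩ := hac.const_of_ae_hasDerivAt_zero (by
    rw [uIcc_of_le hp.lt.le]
    filter_upwards [hp.ae_hasDerivAt_vel, hint.ae_hasDerivAt_integral] with s h1 h2 hs
    rw [uIcc_of_le hp.lt.le] at h2
    have e1 := (h1 hs).1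
    have e2 : HasDerivAt A (f s) s := h2 hs _ (left_mem_Icc.2 hp.lt.le)
    have e3 := e1.smul (e2.neg.cexp)
    have e4 : p.vel s • (Complex.exp ((-A) s) * -f s) +
        derivWithin p.vel (Icc p.left p.right) s • Complex.exp ((-A) s) = 0 := by
      simp only [hf, smul_eq_mul]
      field_simp [hp.ne s hs]
      ring
    rw [e4] at e3
    exact e3)
  rw [uIcc_of_le hp.lt.le] at hC
  have e1 := hC t ht
  have e2 := hC _ (left_mem_Icc.2 hp.lt.le)
  have e3 : A p.left = 0 := by simp [hA]
  simp only [smul_eq_mul, Pi.neg_apply, e3, neg_zero, Complex.exp_zero, mul_one] at e1 e2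
  rw [e2, ← e1, mul_assoc, ← Complex.exp_add]
  simp [hA]

theorem turning_sub (hp : IsCurve p) {s t : ℝ} (hs : s ∈ Icc p.left p.right)
    (ht : t ∈ Icc p.left p.right) :
    p.turning p.left t - p.turning p.left s = p.turning s t := by
  have hi : ∀ z ∈ Icc p.left p.right,
      IntervalIntegrable (fun t => p.curvature t * ‖p.vel t‖) volume p.left z := fun z hz =>
    hp.intervalIntegrable_curvature.mono_set
      (uIcc_subset_uIcc left_mem_uIcc (by rwa [uIcc_of_le hp.lt.le]))
  exact intervalIntegral.integral_interval_sub_left (hi t ht) (hi s hs)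

/-- The imaginary part of ∫ vel' / vel is the turning angle, so the initial angle plus the turning
angle is a continuous direction angle. -/
theorem vel_eq_norm_mul (hp : IsCurve p) {φ : ℝ}
    (hφ : p.vel p.left / (‖p.vel p.left‖ : ℂ) = Complex.exp (φ * Complex.I))
    {t : ℝ} (ht : t ∈ Icc p.left p.right) :
    p.vel t = (‖p.vel t‖ : ℂ) * Complex.exp ((φ + p.turning p.left t : ℝ) * Complex.I) := by
  have hi : IntervalIntegrable (fun s => derivWithin p.vel (Icc p.left p.right) s / p.vel s) volume
      p.left t := hp.intervalIntegrable_logDeriv.mono_set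
    (uIcc_subset_uIcc left_mem_uIcc (by rwa [uIcc_of_le hp.lt.le]))
  have h := hp.vel_eq_mul_exp ht
  set z := ∫ s in p.left..t, derivWithin p.vel (Icc p.left p.right) s / p.vel s with hz
  have him : z.im = p.turning p.left t := by
    have e1 := Complex.imCLM.intervalIntegral_comp_comm hi
    simp only [Complex.imCLM_apply] at e1
    rw [hz, ← e1, PlanePath.turning]
    simp_rw [curvature_mul_norm]
  have hne : (‖p.vel p.left‖ : ℂ) ≠ 0 := by
    exact_mod_cast norm_ne_zero_iff.2 (hp.ne _ (left_mem_Icc.2 hp.lt.le))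
  rw [div_eq_iff hne] at hφ
  rw [h, norm_mul, Complex.norm_exp, ← him]
  conv_lhs => rw [← Complex.re_add_im z, hφ]
  push_cast
  rw [Complex.exp_add, add_mul, Complex.exp_add]
  ring

end IsCurve

/-! ### The half integral -/

theorem hasDerivAt_halfIntegral (x : ℝ) : HasDerivAt halfIntegral (1 / 2 * √(Real.sin x)) x := by
  have hc : Continuous fun τ : ℝ => √(Real.sin τ) := by fun_prop
  exact (hc.integral_hasStrictDerivAt 0 x).hasDerivAt.const_mul (1 / 2)

theorem halfIntegral_zero : halfIntegral 0 = 0 := by simp [halfIntegral]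

theorem continuous_halfIntegral : Continuous halfIntegral :=
  continuous_iff_continuousAt.2 fun x => (hasDerivAt_halfIntegral x).continuousAt

/-- No restriction on the argument is needed, because the square root of a negative number is 0. -/
theorem monotone_halfIntegral : Monotone halfIntegral :=
  monotone_of_deriv_nonneg (fun x => (hasDerivAt_halfIntegral x).differentiableAt) fun x => by
    rw [(hasDerivAt_halfIntegral x).deriv]; positivity

theorem halfIntegral_lt {x y : ℝ} (hx : 0 ≤ x) (hxy : x < y) (hy : y ≤ π) :
    halfIntegral x < halfIntegral y := by
  refine strictMonoOn_of_deriv_pos (convex_Icc 0 π) continuous_halfIntegral.continuousOn ?_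
    ⟨hx, hxy.le.trans hy⟩ ⟨hx.trans hxy.le, hy⟩ hxy
  intro z hz
  rw [interior_Icc] at hz
  rw [(hasDerivAt_halfIntegral z).deriv]
  have := Real.sin_pos_of_mem_Ioo hz
  positivity

theorem halfIntegral_pos {x : ℝ} (hx : 0 < x) (hy : x ≤ π) : 0 < halfIntegral x := by
  simpa [halfIntegral_zero] using halfIntegral_lt le_rfl hx hy

theorem halfIntegral_nonneg {x : ℝ} (hx : 0 ≤ x) : 0 ≤ halfIntegral x := by
  simpa [halfIntegral_zero] using monotone_halfIntegral hx

/-- The integrand is symmetric about π / 2. This converts a frame γ into the opposite frame γ + π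
when the roles of the two turning directions are exchanged. -/
theorem halfIntegral_pi_sub (x : ℝ) : halfIntegral (π - x) = halfIntegral π - halfIntegral x := by
  have h : ∀ x y : ℝ, halfIntegral (π - x) + halfIntegral x = halfIntegral (π - y) + halfIntegral y := by
    refine is_const_of_deriv_eq_zero (f := fun x => halfIntegral (π - x) + halfIntegral x) ?_ ?_
    · intro x
      exact (((hasDerivAt_halfIntegral (π - x)).comp_const_sub π x).add
        (hasDerivAt_halfIntegral x)).differentiableAt
    · intro x
      refine (((hasDerivAt_halfIntegral (π - x)).comp_const_sub π x).add
        (hasDerivAt_halfIntegral x)).deriv.trans ?_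
      rw [Real.sin_pi_sub]
      ring
  have := h x 0
  rw [sub_zero, halfIntegral_zero] at this
  linarith

/-- The Lipschitz bound makes the composition with an absolutely continuous angle absolutely
continuous, as the fundamental theorem of calculus in `PlanePath.IsLift.integral_sqrt_sin` requires.
-/
theorem dist_halfIntegral_le (x y : ℝ) :
    dist (halfIntegral x) (halfIntegral y) ≤ 1 / 2 * dist x y := by
  have := convex_univ.norm_image_sub_le_of_norm_deriv_le (𝕜 := ℝ) (f := halfIntegral) (C := 1 / 2)
    (fun z _ => (hasDerivAt_halfIntegral z).differentiableAt)
    (fun z _ => by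
      rw [(hasDerivAt_halfIntegral z).deriv, Real.norm_of_nonneg (by positivity)]
      have : √(Real.sin z) ≤ 1 := Real.sqrt_le_one.2 (Real.sin_le_one z)
      linarith) (mem_univ y) (mem_univ x)
  simpa [dist_eq_norm] using this

/-! ### The energy bound -/

/-- No sign is assumed: the minorant of κ² used in the energy bound may be negative. -/
theorem ofReal_integral_le_lintegral_ofReal {X : Type*} [MeasurableSpace X] {μ : Measure X}
    {f : X → ℝ} (hf : Integrable f μ) :
    ENNReal.ofReal (∫ x, f x ∂μ) ≤ ∫⁻ x, ENNReal.ofReal (f x) ∂μ := by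
  rw [integral_eq_lintegral_pos_part_sub_lintegral_neg_part hf]
  exact (ENNReal.ofReal_le_ofReal (sub_le_self _ ENNReal.toReal_nonneg)).trans
    ENNReal.ofReal_toReal_le

/-- `θ` is a continuous direction angle along `p`. -/
structure PlanePath.IsLift (p : PlanePath) (θ : ℝ → ℝ) : Prop where
  vel_eq : ∀ t ∈ Icc p.left p.right,
    p.vel t = (‖p.vel t‖ : ℂ) * Complex.exp ((θ t : ℝ) * Complex.I)
  eq_turning : ∀ t, θ t = θ p.left + p.turning p.left t

namespace PlanePath.IsLift

variable {p : PlanePath} {θ : ℝ → ℝ}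

theorem ac (hθ : p.IsLift θ) (hp : IsCurve p) :
    AbsolutelyContinuousOnInterval θ p.left p.right := by
  refine absolutelyContinuousOnInterval_of_dist_le (K := 1)
    (absolutelyContinuousOnInterval_integral hp.intervalIntegrable_curvature) fun x _ y _ => ?_
  rw [hθ.eq_turning x, hθ.eq_turning y, one_mul, dist_add_left]
  rfl

theorem continuousOn (hθ : p.IsLift θ) (hp : IsCurve p) : ContinuousOn θ (Icc p.left p.right) := by
  have := (hθ.ac hp).continuousOn
  rwa [uIcc_of_le hp.lt.le] at this

theorem sub_eq_turning (hθ : p.IsLift θ) (hp : IsCurve p) {s t : ℝ} (hs : s ∈ Icc p.left p.right)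
    (ht : t ∈ Icc p.left p.right) : θ t - θ s = p.turning s t := by
  rw [hθ.eq_turning t, hθ.eq_turning s, ← hp.turning_sub hs ht]
  ring

theorem ae_hasDerivAt (hθ : p.IsLift θ) (hp : IsCurve p) : ∀ᵐ t, t ∈ Icc p.left p.right →
    HasDerivAt θ (p.curvature t * ‖p.vel t‖) t := by
  have h := hp.intervalIntegrable_curvature.ae_hasDerivAt_integral
  rw [uIcc_of_le hp.lt.le] at h
  filter_upwards [h] with t h ht
  have h1 := (h ht _ (left_mem_Icc.2 hp.lt.le)).const_add (θ p.left)
  exact h1.congr_of_eventuallyEq (Filter.Eventually.of_forall fun s => hθ.eq_turning s)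

theorem integral_sqrt_sin (hθ : p.IsLift θ) (hp : IsCurve p) (γ : ℝ) {s t : ℝ}
    (hs : s ∈ Icc p.left p.right) (ht : t ∈ Icc p.left p.right) :
    ∫ x in s..t, √(Real.sin (θ x - γ)) * (p.curvature x * ‖p.vel x‖) =
      2 * halfIntegral (θ t - γ) - 2 * halfIntegral (θ s - γ) := by
  have hsub : uIcc s t ⊆ uIcc p.left p.right := by
    rw [uIcc_of_le hp.lt.le]; exact uIcc_subset_Icc hs ht
  have hac : AbsolutelyContinuousOnInterval (fun x => 2 * halfIntegral (θ x - γ)) s t := by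
    refine absolutelyContinuousOnInterval_of_dist_le (K := 1) ((hθ.ac hp).mono hsub)
      fun x _ y _ => ?_
    have h1 := dist_halfIntegral_le (θ x - γ) (θ y - γ)
    rw [dist_sub_right] at h1
    rw [Real.dist_eq, ← mul_sub, abs_mul, abs_of_pos (by norm_num : (0 : ℝ) < 2), ← Real.dist_eq]
    linarith
  rw [← hac.integral_deriv_eq_sub]
  refine intervalIntegral.integral_congr_ae ?_
  filter_upwards [hθ.ae_hasDerivAt hp] with x hx hxm
  have hx' := hx (by rw [← uIcc_of_le hp.lt.le]; exact hsub (uIoc_subset_uIcc hxm))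
  have := (((hasDerivAt_halfIntegral (θ x - γ)).comp x (hx'.sub_const γ)).const_mul 2).deriv
  refine (Eq.trans this ?_).symm
  ring

theorem intervalIntegrable_norm_mul_sin (hθ : p.IsLift θ) (hp : IsCurve p) (γ : ℝ) {s t : ℝ}
    (hs : s ∈ Icc p.left p.right) (ht : t ∈ Icc p.left p.right) :
    IntervalIntegrable (fun x => ‖p.vel x‖ * Real.sin (θ x - γ)) volume s t := by
  refine ContinuousOn.intervalIntegrable ?_
  refine ContinuousOn.mono ?_ (uIcc_subset_Icc hs ht)
  exact hp.continuousOn_vel.norm.mul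
    (Real.continuous_sin.comp_continuousOn ((hθ.continuousOn hp).sub continuousOn_const))

/-- After rotation by -γ the imaginary part of the velocity is ‖vel‖ sin (θ - γ); integrating gives
the height of the chord in the rotated frame. -/
theorem integral_norm_mul_sin (hθ : p.IsLift θ) (hp : IsCurve p) (γ : ℝ) :
    ∫ x in p.left..p.right, ‖p.vel x‖ * Real.sin (θ x - γ) =
      (Complex.exp (-γ * Complex.I) * (p.toFun p.right - p.toFun p.left)).im := by
  have hint : IntervalIntegrable p.vel volume p.left p.right := by
    refine ContinuousOn.intervalIntegrable ?_
    rw [uIcc_of_le hp.lt.le]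
    exact hp.continuousOn_vel
  have h1 : ∫ x in p.left..p.right, p.vel x = p.toFun p.right - p.toFun p.left := by
    refine intervalIntegral.integral_eq_sub_of_hasDerivAt_of_le hp.lt.le hp.diff.continuousOn
      (fun x hx => ?_) hint
    exact (hp.diff x (Ioo_subset_Icc_self hx)).hasDerivWithinAt.hasDerivAt (Icc_mem_nhds hx.1 hx.2)
  rw [← h1, ← intervalIntegral.integral_const_mul]
  have h2 := Complex.imCLM.intervalIntegral_comp_comm (hint.const_mul (Complex.exp (-γ * Complex.I)))
  simp only [Complex.imCLM_apply] at h2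
  rw [← h2]
  refine intervalIntegral.integral_congr fun x hx => ?_
  rw [uIcc_of_le hp.lt.le] at hx
  show _ = (Complex.exp (-γ * Complex.I) * p.vel x).im
  conv_rhs => rw [hθ.vel_eq x hx, mul_left_comm, ← Complex.exp_add, Complex.im_ofReal_mul]
  congr 1
  rw [← Complex.exp_ofReal_mul_I_im]
  congr 2
  push_cast
  ring

/-- This is the expansion of (κ - μ √sin (θ - γ))² ≥ 0, integrated over [s, t] with respect to arc
length. The sign of μ is free, so that the two sides of an inflection can be given opposite signs.
-/
theorem ofReal_le_lintegral (hθ : p.IsLift θ) (hp : IsCurve p) {γ s t : ℝ}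
    (hs : s ∈ Icc p.left p.right) (ht : t ∈ Icc p.left p.right) (hst : s ≤ t)
    (hsin : ∀ x ∈ Icc p.left p.right, 0 ≤ Real.sin (θ x - γ)) (μ : ℝ) :
    ENNReal.ofReal (2 * μ * (2 * halfIntegral (θ t - γ) - 2 * halfIntegral (θ s - γ)) -
      μ ^ 2 * ∫ x in s..t, ‖p.vel x‖ * Real.sin (θ x - γ)) ≤
    ∫⁻ x in Ioc s t, ENNReal.ofReal (p.curvature x ^ 2 * ‖p.vel x‖) := by
  have hsub : uIcc s t ⊆ Icc p.left p.right := uIcc_subset_Icc hs ht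
  have i1 : IntervalIntegrable (fun x => √(Real.sin (θ x - γ)) * (p.curvature x * ‖p.vel x‖))
      volume s t := by
    refine IntervalIntegrable.continuousOn_mul (hp.intervalIntegrable_curvature.mono_set ?_) ?_
    · rwa [uIcc_of_le hp.lt.le]
    · exact (Real.continuous_sqrt.comp Real.continuous_sin).comp_continuousOn
        (((hθ.continuousOn hp).mono hsub).sub continuousOn_const)
  have i2 := hθ.intervalIntegrable_norm_mul_sin hp γ hs ht
  have i3 := (i1.const_mul (2 * μ)).sub (i2.const_mul (μ ^ 2))
  rw [← hθ.integral_sqrt_sin hp γ hs ht, ← intervalIntegral.integral_const_mul,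
    ← intervalIntegral.integral_const_mul, ← intervalIntegral.integral_sub (i1.const_mul _)
    (i2.const_mul _), intervalIntegral.integral_of_le hst]
  rw [intervalIntegrable_iff, uIoc_of_le hst] at i3
  refine (ofReal_integral_le_lintegral_ofReal i3).trans ?_
  refine setLIntegral_mono' measurableSet_Ioc fun x hx => ENNReal.ofReal_le_ofReal ?_
  have h0 := hsin x (hsub (by rw [uIcc_of_le hst]; exact Ioc_subset_Icc_self hx))
  have h1 := Real.sq_sqrt h0
  have h2 : 0 ≤ ‖p.vel x‖ * (p.curvature x - μ * √(Real.sin (θ x - γ))) ^ 2 := by positivity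
  generalize √(Real.sin (θ x - γ)) = q at h1 h2 ⊢
  rw [← h1]
  linarith

/-- Adding the quadratic bounds with -μ before m and μ after m gives ∫ κ² ds ≥ 4 μ Y - μ² h. With m
an inflection of angle γ the last term of Y vanishes; with m an end point the bound is the one
adapted to a curve of constant turning direction. -/
theorem ofReal_le_energy (hθ : p.IsLift θ) (hp : IsCurve p) {γ m h : ℝ}
    (hm : m ∈ Icc p.left p.right) (hsin : ∀ x ∈ Icc p.left p.right, 0 ≤ Real.sin (θ x - γ))
    (hh : (Complex.exp (-γ * Complex.I) * (p.toFun p.right - p.toFun p.left)).im = h)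
    (hpos : 0 < h) :
    ENNReal.ofReal ((halfIntegral (θ p.left - γ) + halfIntegral (θ p.right - γ) -
      2 * halfIntegral (θ m - γ)) ^ 2 / h) ≤ p.energy := by
  have hl := left_mem_Icc.2 hp.lt.le
  have hr := right_mem_Icc.2 hp.lt.le
  set Y := halfIntegral (θ p.left - γ) + halfIntegral (θ p.right - γ) - 2 * halfIntegral (θ m - γ)
  -- The value μ = 2 Y / h maximizes 4 μ Y - μ² h, with maximum 4 Y² / h.
  have h1 := hθ.ofReal_le_lintegral hp hl hm hm.1 hsin (-(2 * Y / h))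
  have h2 := hθ.ofReal_le_lintegral hp hm hr hm.2 hsin (2 * Y / h)
  have h3 := intervalIntegral.integral_add_adjacent_intervals
    (hθ.intervalIntegrable_norm_mul_sin hp γ hl hm) (hθ.intervalIntegrable_norm_mul_sin hp γ hm hr)
  rw [hθ.integral_norm_mul_sin hp γ, hh] at h3
  have h4 : ENNReal.ofReal (4 * (Y ^ 2 / h)) ≤
      ∫⁻ x in Icc p.left p.right, ENNReal.ofReal (p.curvature x ^ 2 * ‖p.vel x‖) := by
    have hu : Ioc p.left m ∪ Ioc m p.right ⊆ Icc p.left p.right := by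
      rw [Ioc_union_Ioc_eq_Ioc hm.1 hm.2]; exact Ioc_subset_Icc_self
    refine le_trans ?_ (lintegral_mono_set hu)
    rw [lintegral_union measurableSet_Ioc (Ioc_disjoint_Ioc_of_le le_rfl)]
    refine le_trans ?_ (add_le_add h1 h2)
    refine le_trans (ENNReal.ofReal_le_ofReal (le_of_eq ?_)) ENNReal.ofReal_add_le
    set J := ∫ x in p.left..m, ‖p.vel x‖ * Real.sin (θ x - γ)
    have : ∫ x in m..p.right, ‖p.vel x‖ * Real.sin (θ x - γ) = h - J := by linarith
    rw [this]
    simp only [Y]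
    field_simp
    ring
  unfold PlanePath.energy
  calc ENNReal.ofReal (Y ^ 2 / h) = (1 / 4) * ENNReal.ofReal (4 * (Y ^ 2 / h)) := by
        rw [ENNReal.ofReal_mul (by norm_num), ← mul_assoc]
        have : (1 / 4 : ℝ≥0∞) * ENNReal.ofReal 4 = 1 := by
          rw [ENNReal.ofReal_ofNat, one_div]
          exact ENNReal.inv_mul_cancel (by norm_num) (by norm_num)
        rw [this, one_mul]
    _ ≤ _ := by gcongr

end PlanePath.IsLift

/-! ### Directions along an s-curve -/

theorem PlanePath.turning_self (p : PlanePath) (a : ℝ) : p.turning a a = 0 := by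
  simp [PlanePath.turning]

theorem IsCurve.exists_lift {p : PlanePath} (hp : IsCurve p) {z : ℂ} {φ : ℝ}
    (h : p.IsTangentAt p.left (UnitTangent.ofAngle z φ)) : ∃ θ, p.IsLift θ ∧ θ p.left = φ :=
  ⟨fun t => φ + p.turning p.left t,
    ⟨fun _ ht => hp.vel_eq_norm_mul h.2 ht, fun t => by simp [p.turning_self]⟩,
    by simp [p.turning_self]⟩

namespace PlanePath.IsLift

variable {p : PlanePath} {θ : ℝ → ℝ}

theorem monotoneOn (hθ : p.IsLift θ) (hp : IsCurve p) {a b : ℝ} (ha : a ∈ Icc p.left p.right)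
    (hb : b ∈ Icc p.left p.right) (h : p.IsLeftCOn a b) : MonotoneOn θ (Icc a b) := by
  intro s hs t ht hst
  have hsub : Icc a b ⊆ Icc p.left p.right := Icc_subset_Icc ha.1 hb.2
  rw [← sub_nonneg, hθ.sub_eq_turning hp (hsub hs) (hsub ht)]
  refine intervalIntegral.integral_nonneg_of_ae_restrict hst ?_
  filter_upwards [ae_restrict_of_ae_restrict_of_subset (Icc_subset_Icc hs.1 ht.2) h.1] with x hx
  exact mul_nonneg hx (norm_nonneg _)

theorem antitoneOn (hθ : p.IsLift θ) (hp : IsCurve p) {a b : ℝ} (ha : a ∈ Icc p.left p.right)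
    (hb : b ∈ Icc p.left p.right) (h : p.IsRightCOn a b) : AntitoneOn θ (Icc a b) := by
  intro s hs t ht hst
  have hsub : Icc a b ⊆ Icc p.left p.right := Icc_subset_Icc ha.1 hb.2
  rw [← sub_nonpos, hθ.sub_eq_turning hp (hsub hs) (hsub ht), ← neg_nonneg, PlanePath.turning,
    ← intervalIntegral.integral_neg]
  refine intervalIntegral.integral_nonneg_of_ae_restrict hst ?_
  filter_upwards [ae_restrict_of_ae_restrict_of_subset (Icc_subset_Icc hs.1 ht.2) h.1] with x hx
  exact neg_nonneg.2 (mul_nonpos_of_nonpos_of_nonneg hx (norm_nonneg _))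

/-- A curve from `0` to `1` with all directions in the half circle starting at `γ` and initial
direction above the real axis has `sin γ < 0`. -/
theorem sin_neg_of_mem_halfcircle (hθ : p.IsLift θ) (hp : IsCurve p) (h0 : p.toFun p.left = 0)
    (h1 : p.toFun p.right = 1) (hα : θ p.left ∈ Ioc 0 π) {γ : ℝ}
    (hγ : ∀ t ∈ Icc p.left p.right, θ t - γ ∈ Icc 0 π) : Real.sin γ < 0 := by
  have key : ∀ ψ : ℝ, ∫ x in p.left..p.right, ‖p.vel x‖ * Real.sin (θ x - ψ) = -Real.sin ψ := by
    intro ψ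
    rw [hθ.integral_norm_mul_sin hp ψ, h0, h1, sub_zero, mul_one, ← Complex.ofReal_neg,
      Complex.exp_ofReal_mul_I_im, Real.sin_neg]
  have hc := hθ.continuousOn hp
  have hcont : ∀ ψ : ℝ, ContinuousOn (fun x => ‖p.vel x‖ * Real.sin (θ x - ψ))
      (Icc p.left p.right) := fun ψ =>
    hp.continuousOn_vel.norm.mul (Real.continuous_sin.comp_continuousOn (hc.sub continuousOn_const))
  have hl := left_mem_Icc.2 hp.lt.le
  by_contra hneg
  push Not at hneg
  -- If sin γ ≥ 0, the height -sin γ of the chord is at most 0 although it is the integral of a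
  -- nonnegative function. So the integrand vanishes and, by connectedness, the direction is
  -- constant.
  have hzero : ∀ t ∈ Icc p.left p.right, Real.sin (θ t - γ) = 0 := by
    intro t ht
    by_contra hne
    have hpos := lt_of_le_of_ne (Real.sin_nonneg_of_mem_Icc (hγ t ht)) (Ne.symm hne)
    have := intervalIntegral.integral_pos hp.lt (hcont γ)
      (fun x hx => mul_nonneg (norm_nonneg _)
        (Real.sin_nonneg_of_mem_Icc (hγ x (Ioc_subset_Icc_self hx))))
      ⟨t, ht, mul_pos (norm_pos_iff.2 (hp.ne t ht)) hpos⟩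
    rw [key] at this
    linarith
  have hval : ∀ t ∈ Icc p.left p.right, θ t - γ = 0 ∨ θ t - γ = π := by
    intro t ht
    by_contra hne
    push Not at hne
    exact (Real.sin_pos_of_mem_Ioo ⟨lt_of_le_of_ne (hγ t ht).1 hne.1.symm,
      lt_of_le_of_ne (hγ t ht).2 hne.2⟩).ne' (hzero t ht)
  have hmid : γ + π / 2 ∉ θ '' Icc p.left p.right := by
    rintro ⟨t, ht, h⟩
    have := Real.pi_pos
    rcases hval t ht with h' | h' <;> linarith
  have hconn : OrdConnected (θ '' Icc p.left p.right) :=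
    (isPreconnected_Icc.image θ hc).ordConnected
  have hconst : ∀ t ∈ Icc p.left p.right, θ t = θ p.left := by
    intro t ht
    have := Real.pi_pos
    by_contra hne
    rcases hval t ht with h | h <;> rcases hval _ hl with h' | h'
    · exact hne (by linarith)
    · exact hmid (hconn.out (mem_image_of_mem θ ht) (mem_image_of_mem θ hl)
        ⟨by linarith, by linarith⟩)
    · exact hmid (hconn.out (mem_image_of_mem θ hl) (mem_image_of_mem θ ht)
        ⟨by linarith, by linarith⟩)
    · exact hne (by linarith)
  have hsin : Real.sin (θ p.left) = 0 := by
    have := key (θ p.left)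
    rw [intervalIntegral.integral_congr (g := fun _ => (0 : ℝ)) (fun x hx => by
      rw [uIcc_of_le hp.lt.le] at hx
      show ‖p.vel x‖ * Real.sin (θ x - θ p.left) = 0
      rw [hconst x hx, sub_self, Real.sin_zero, mul_zero])] at this
    simpa using this
  have hpi : θ p.left = π := by
    by_contra hne
    exact (Real.sin_pos_of_mem_Ioo ⟨hα.1, lt_of_le_of_ne hα.2 hne⟩).ne' hsin
  -- What remains is a straight line in direction π, which cannot lead from 0 to 1: in the frame π /
  -- 2 its height integral is positive, whereas the chord gives -1.
  have hsin' : ∀ t ∈ Icc p.left p.right, Real.sin (θ t - π / 2) = 1 := fun t ht => by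
    rw [hconst t ht, hpi, sub_half, Real.sin_pi_div_two]
  have := intervalIntegral.integral_pos hp.lt (hcont (π / 2))
    (fun x hx => by
      show 0 ≤ ‖p.vel x‖ * Real.sin (θ x - π / 2)
      rw [hsin' x (Ioc_subset_Icc_self hx), mul_one]; exact norm_nonneg _)
    ⟨p.left, hl, by
      show 0 < ‖p.vel p.left‖ * Real.sin (θ p.left - π / 2)
      rw [hsin' _ hl, mul_one]; exact norm_pos_iff.2 (hp.ne _ hl)⟩
  rw [key, Real.sin_pi_div_two] at this
  linarith

end PlanePath.IsLift

theorem IsSCurve.isCurve {p : PlanePath} (h : IsSCurve p) : IsCurve p := by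
  rcases h with h | h
  exacts [h.1, h.1]

/-- A c-curve is treated as split at its right end, with a degenerate second arc of turning angle 0;
hence m ranges over the closed interval. -/
theorem IsSCurve.exists_split {p : PlanePath} (h : IsSCurve p) : ∃ m ∈ Icc p.left p.right,
    (p.IsRightCOn p.left m ∧ p.IsLeftCOn m p.right) ∨
      (p.IsLeftCOn p.left m ∧ p.IsRightCOn m p.right) := by
  have hpi := Real.pi_pos
  rcases h with ⟨hp, h | h⟩ | ⟨hp, m, hm, h | h⟩
  · refine ⟨p.right, right_mem_Icc.2 hp.lt.le, Or.inr ⟨h, by simp, ?_⟩⟩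
    rw [p.turning_self]; linarith
  · refine ⟨p.right, right_mem_Icc.2 hp.lt.le, Or.inl ⟨h, by simp, ?_⟩⟩
    rw [p.turning_self]; linarith
  · exact ⟨m, Ioo_subset_Icc_self hm, Or.inr h⟩
  · exact ⟨m, Ioo_subset_Icc_self hm, Or.inl h⟩

/-- Each c-curve turns by at most π, so the extreme angle θ m at the split determines a half circle
containing all directions: it starts at θ m for right-left curves and at θ m - π for left-right
ones. The necessary conditions on α and β follow from the negative sine that such a half circle must
have. -/
theorem directions_of_mem_sCurves {α β : ℝ} (hα : α ∈ Ioc 0 π) (hβ : |β| ≤ α) {q : PlanePath}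
    (hq : q ∈ sCurves (UnitTangent.ofAngle 0 α) (UnitTangent.ofAngle 1 β)) :
    α < π ∧ α - π ≤ β ∧ ∃ θ : ℝ → ℝ, ∃ m ∈ Icc q.left q.right, q.IsLift θ ∧ θ q.left = α ∧
      θ q.right = β ∧
      ((θ m ∈ Gam α β ∧ ∀ t ∈ Icc q.left q.right, θ t ∈ Icc (θ m) α) ∨
        (β < 0 ∧ α ≤ θ m ∧ θ m ≤ β + π ∧ ∀ t ∈ Icc q.left q.right, θ t ∈ Icc β (θ m))) := by
  obtain ⟨hs, hu, hv⟩ := hq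
  have hq := hs.isCurve
  obtain ⟨θ, hθ, hθl⟩ := hq.exists_lift hu
  obtain ⟨m, hm, hsplit⟩ := hs.exists_split
  have hl := left_mem_Icc.2 hq.lt.le
  have hr := right_mem_Icc.2 hq.lt.le
  have hπ := Real.pi_pos
  obtain ⟨hβ1, hβ2⟩ := abs_le.1 hβ
  -- The terminal tangent vector fixes the angle only modulo 2π.
  obtain ⟨n, hn⟩ : ∃ n : ℤ, θ q.right = β + n * (2 * π) := by
    have h1 := hv.2
    have h2 := hθ.vel_eq _ hr
    have hne : (‖q.vel q.right‖ : ℂ) ≠ 0 := by exact_mod_cast norm_ne_zero_iff.2 (hq.ne _ hr)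
    rw [div_eq_iff hne] at h1
    have h3 := mul_left_cancel₀ hne ((mul_comm _ _).trans (h1.symm.trans h2))
    obtain ⟨n, hn⟩ := Complex.exp_eq_exp_iff_exists_int.1 h3.symm
    refine ⟨n, ?_⟩
    have := congrArg Complex.im hn
    simpa using this
  -- Since sin γ < 0 and γ ≤ α ≤ π, the frame satisfies γ < 0. The interval [γ, γ + π] with α - π ≤
  -- γ < 0 then contains no translate of β by a nonzero multiple of 2π, because -α ≤ β ≤ α.
  have key : ∀ γ : ℝ, α - π ≤ γ → γ ≤ α → (∀ t ∈ Icc q.left q.right, θ t - γ ∈ Icc 0 π) →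
      α < π ∧ α - π ≤ β ∧ γ < 0 ∧ θ q.right = β := by
    intro γ h1 h2 h3
    have hs := hθ.sin_neg_of_mem_halfcircle hq hu.1 hv.1 (by rwa [hθl]) h3
    have hγ0 : γ < 0 := by
      by_contra hge
      push Not at hge
      exact hs.not_ge (Real.sin_nonneg_of_mem_Icc ⟨hge, h2.trans hα.2⟩)
    have h4 := h3 _ hr
    have h0 := hα.1
    have hα2 := hα.2
    have hn0 : n = 0 := by
      have e1 : (n : ℝ) < 1 := by
        by_contra hge
        push Not at hge
        have := h4.2
        rw [hn] at this
        nlinarith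
      have e2 : (-1 : ℝ) < n := by
        by_contra hge
        push Not at hge
        have := h4.1
        rw [hn] at this
        nlinarith
      have e1' : n < 1 := by exact_mod_cast e1
      have e2' : -1 < n := by exact_mod_cast e2
      omega
    have hθr : θ q.right = β := by rw [hn, hn0]; simp
    rw [hθr] at h4
    exact ⟨by linarith, by linarith [h4.1], hγ0, hθr⟩
  rcases hsplit with ⟨hR, hL⟩ | ⟨hL, hR⟩
  · have hanti := hθ.antitoneOn hq hl hm hR
    have hmono := hθ.monotoneOn hq hm hr hL
    have t1 := hθ.sub_eq_turning hq hl hm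
    have t2 := hθ.sub_eq_turning hq hm hr
    have r1 := hR.2
    have r2 := hL.2
    have hge : ∀ t ∈ Icc q.left q.right, θ m ≤ θ t := by
      intro t ht
      rcases le_total t m with h | h
      · exact hanti ⟨ht.1, h⟩ ⟨hm.1, le_rfl⟩ h
      · exact hmono ⟨le_rfl, hm.2⟩ ⟨h, ht.2⟩ h
    have hle : ∀ t ∈ Icc q.left q.right, θ t ≤ α ∨ θ t ≤ θ q.right := by
      intro t ht
      rcases le_total t m with h | h
      · rw [← hθl]; exact Or.inl (hanti ⟨le_rfl, hm.1⟩ ⟨ht.1, h⟩ ht.1)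
      · exact Or.inr (hmono ⟨h, ht.2⟩ ⟨hm.2, le_rfl⟩ ht.2)
    obtain ⟨k1, k2, k3, k4⟩ := key (θ m) (by linarith) (by linarith [hge _ hl]) fun t ht =>
      ⟨by linarith [hge t ht], by rcases hle t ht with h | h <;> linarith⟩
    refine ⟨k1, k2, θ, m, hm, hθ, hθl, k4, Or.inl ⟨?_, fun t ht => ⟨hge t ht, ?_⟩⟩⟩
    · have := hge _ hr
      unfold Gam
      split_ifs
      · exact ⟨by linarith, by linarith⟩
      · exact ⟨by linarith, k3⟩
    · rcases hle t ht with h | h <;> linarith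
  · have hanti := hθ.antitoneOn hq hm hr hR
    have hmono := hθ.monotoneOn hq hl hm hL
    have t1 := hθ.sub_eq_turning hq hl hm
    have t2 := hθ.sub_eq_turning hq hm hr
    have r1 := hR.2
    have r2 := hL.2
    have hle : ∀ t ∈ Icc q.left q.right, θ t ≤ θ m := by
      intro t ht
      rcases le_total t m with h | h
      · exact hmono ⟨ht.1, h⟩ ⟨hm.1, le_rfl⟩ h
      · exact hanti ⟨le_rfl, hm.2⟩ ⟨h, ht.2⟩ h
    have hge : ∀ t ∈ Icc q.left q.right, α ≤ θ t ∨ θ q.right ≤ θ t := by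
      intro t ht
      rcases le_total t m with h | h
      · rw [← hθl]; exact Or.inl (hmono ⟨le_rfl, hm.1⟩ ⟨ht.1, h⟩ ht.1)
      · exact Or.inr (hanti ⟨h, ht.2⟩ ⟨hm.2, le_rfl⟩ ht.2)
    obtain ⟨k1, k2, k3, k4⟩ := key (θ m - π) (by linarith [hle _ hl]) (by linarith) fun t ht =>
      ⟨by rcases hge t ht with h | h <;> linarith, by linarith [hle t ht]⟩
    -- For β ≥ 0 all directions would lie in [0, π], and the frame γ = 0 would give sin 0 < 0.
    have hβ0 : β < 0 := by
      by_contra hge0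
      push Not at hge0
      have := hθ.sin_neg_of_mem_halfcircle hq hu.1 hv.1 (by rwa [hθl]) (γ := 0) fun t ht => by
        have := hle t ht
        have h0 := hα.1
        rw [sub_zero]
        exact ⟨by rcases hge t ht with h | h <;> linarith, by linarith⟩
      simp at this
    refine ⟨k1, k2, θ, m, hm, hθ, hθl, k4, Or.inr ⟨hβ0, by linarith [hle _ hl], by linarith,
      fun t ht => ⟨?_, hle t ht⟩⟩⟩
    rcases hge t ht with h | h <;> linarith

/-! ### First order conditions for `G` -/

theorem mem_Gam_bounds {α β γ : ℝ} (h : γ ∈ Gam α β) :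
    α - π ≤ γ ∧ γ < 0 ∧ γ ≤ β := by
  unfold Gam at h
  split_ifs at h with hβ
  · exact ⟨h.1, h.2.trans_lt hβ, h.2⟩
  · exact ⟨h.1, h.2, h.2.le.trans (not_lt.1 hβ)⟩

theorem ySum_pos {α β γ : ℝ} (hα : 0 < α) (h1 : α - π ≤ γ) (h2 : γ < 0) (h3 : γ ≤ β) :
    0 < ySum α β γ :=
  add_pos_of_pos_of_nonneg (halfIntegral_pos (by linarith) (by linarith))
    (halfIntegral_nonneg (by linarith))

theorem neg_sin_pos {α γ : ℝ} (hα : 0 < α) (h1 : α - π ≤ γ) (h2 : γ < 0) : 0 < -Real.sin γ := by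
  rw [← Real.sin_neg]
  exact Real.sin_pos_of_mem_Ioo ⟨by linarith, by linarith⟩

/-- The remaining factors of the derivative are positive, so σ carries its sign. The same σ measures
how far the elastica arc is from fitting the chord. -/
theorem hasDerivAt_G {α β γ : ℝ} (hy : ySum α β γ ≠ 0) (hs : Real.sin γ ≠ 0) :
    HasDerivAt (G α β) (ySum α β γ ^ 2 * sigma α β γ / Real.sin γ ^ 2) γ := by
  have h1 : HasDerivAt (ySum α β) _ γ :=
    ((hasDerivAt_halfIntegral (α - γ)).comp_const_sub α γ).add
      ((hasDerivAt_halfIntegral (β - γ)).comp_const_sub β γ)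
  have h2 := (h1.pow 2).div (Real.hasDerivAt_sin γ).neg (neg_ne_zero.2 hs)
  refine h2.congr_deriv ?_
  simp only [sigma, Pi.pow_apply, Pi.neg_apply]
  field_simp
  ring

theorem nonneg_deriv_of_min_right {f : ℝ → ℝ} {f' x y : ℝ} (hf : HasDerivAt f f' x) (hxy : x < y)
    (h : ∀ z ∈ Ioo x y, f x ≤ f z) : 0 ≤ f' := by
  refine ge_of_tendsto (hf.tendsto_slope.mono_left
    (nhdsWithin_mono x (s := Ioi x) fun z hz => ne_of_gt hz)) ?_
  filter_upwards [Ioo_mem_nhdsGT hxy] with z hz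
  rw [slope_def_field]
  exact div_nonneg (sub_nonneg.2 (h z hz)) (sub_nonneg.2 hz.1.le)

theorem deriv_nonpos_of_min_left {f : ℝ → ℝ} {f' x y : ℝ} (hf : HasDerivAt f f' x) (hxy : y < x)
    (h : ∀ z ∈ Ioo y x, f x ≤ f z) : f' ≤ 0 := by
  refine le_of_tendsto (hf.tendsto_slope.mono_left
    (nhdsWithin_mono x (s := Iio x) fun z hz => ne_of_lt hz)) ?_
  filter_upwards [Ioo_mem_nhdsLT hxy] with z hz
  rw [slope_def_field]
  exact div_nonpos_of_nonneg_of_nonpos (sub_nonneg.2 (h z hz)) (sub_nonpos.2 hz.2.le)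

/-- One-sided derivatives at a minimum: room on the right gives σ ≥ 0, room on the left gives σ ≤ 0.
Room on the right is missing only at γ = β < 0, where the hypothesis on σ(β) replaces it. -/
theorem sigma_of_isMinOn {α β γ : ℝ} (hα : 0 < α)
    (hσ : 0 ≤ β ∨ 0 ≤ sigma α β β) (hγ : γ ∈ Gam α β) (hmin : IsMinOn (G α β) (Gam α β) γ) :
    0 ≤ sigma α β γ ∧ (α - π < γ → sigma α β γ = 0) := by
  obtain ⟨h1, h2, h3⟩ := mem_Gam_bounds hγ
  have hy := ySum_pos hα h1 h2 h3
  have hs := neg_sin_pos hα h1 h2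
  have hd := hasDerivAt_G hy.ne' (neg_ne_zero.1 hs.ne')
  have hs2 : 0 < Real.sin γ ^ 2 := by nlinarith
  have hy2 : 0 < ySum α β γ ^ 2 := by positivity
  have hnn : 0 ≤ sigma α β γ := by
    have hroom : (∃ y, γ < y ∧ Ioo γ y ⊆ Gam α β) ∨ γ = β ∧ β < 0 := by
      unfold Gam
      split_ifs with hβ
      · rcases h3.lt_or_eq with h | h
        · exact Or.inl ⟨β, h, fun z hz => ⟨by linarith [hz.1], hz.2.le⟩⟩
        · exact Or.inr ⟨h, hβ⟩
      · exact Or.inl ⟨0, h2, fun z hz => ⟨by linarith [hz.1], hz.2⟩⟩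
    rcases hroom with ⟨y, hy', hsub⟩ | ⟨rfl, hβ⟩
    · have := nonneg_deriv_of_min_right hd hy' fun z hz => hmin (hsub hz)
      by_contra hneg
      push Not at hneg
      have := div_neg_of_neg_of_pos (mul_neg_of_pos_of_neg hy2 hneg) hs2
      linarith
    · rcases hσ with h | h
      · linarith
      · exact h
  refine ⟨hnn, fun hlt => le_antisymm ?_ hnn⟩
  have hsub : Ioo (α - π) γ ⊆ Gam α β := fun z hz => by
    unfold Gam
    split_ifs with hβ
    · exact ⟨hz.1.le, by linarith [hz.2]⟩
    · exact ⟨hz.1.le, by linarith [hz.2]⟩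
  have := deriv_nonpos_of_min_left hd hlt fun z hz => hmin (hsub hz)
  by_contra hpos
  push Not at hpos
  have := div_pos (mul_pos hy2 hpos) hs2
  linarith

theorem exists_isMinOn_G {α β : ℝ} (hα : 0 < α) (hαπ : α < π) (hαβ : α - π ≤ β) :
    ∃ γ ∈ Gam α β, IsMinOn (G α β) (Gam α β) γ := by
  have hcont : ∀ x, x < 0 → x ≤ β → ContinuousOn (G α β) (Icc (α - π) x) := fun x hx hxβ y hy =>
    (hasDerivAt_G (ySum_pos hα hy.1 (hy.2.trans_lt hx) (hy.2.trans hxβ)).ne'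
      (neg_ne_zero.1 (neg_sin_pos hα hy.1 (hy.2.trans_lt hx)).ne')).continuousAt.continuousWithinAt
  by_cases hβ : β < 0
  · have hG : Gam α β = Icc (α - π) β := by simp [Gam, hβ]
    rw [hG]
    exact isCompact_Icc.exists_isMinOn (nonempty_Icc.2 hαβ) (hcont β hβ le_rfl)
  · have hG : Gam α β = Ico (α - π) 0 := by simp [Gam, hβ]
    rw [hG]
    push Not at hβ
    have hlt : α - π < 0 := by linarith
    have hy0 := halfIntegral_pos hα hαπ.le
    have hG0 : 0 < G α β (α - π) := div_pos
      (pow_pos (ySum_pos hα le_rfl hlt (by linarith)) 2) (neg_sin_pos hα le_rfl hlt)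
    -- For β ≥ 0 the set is open at 0, where G blows up. Since y₁ + y₂ ≥ H(α) and -sin z ≤ -z, the
    -- cutoff is chosen so that G ≥ H(α)² / (-z) ≥ G(α - π) beyond it.
    set x := max (α - π) (-(halfIntegral α ^ 2 / G α β (α - π)))
    have hx0 : x < 0 := max_lt hlt (by rw [neg_lt_zero]; positivity)
    have hαx : α - π ≤ x := le_max_left _ _
    obtain ⟨γ, hγ, hmin⟩ := isCompact_Icc.exists_isMinOn (nonempty_Icc.2 hαx)
      (hcont x hx0 (by linarith))
    refine ⟨γ, ⟨hγ.1, hγ.2.trans_lt hx0⟩, fun z hz => ?_⟩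
    rcases le_total z x with h | h
    · exact hmin ⟨hz.1, h⟩
    · have h0 : G α β γ ≤ G α β (α - π) := hmin ⟨le_rfl, hαx⟩
      refine h0.trans ?_
      have h1 : -(halfIntegral α ^ 2 / G α β (α - π)) ≤ z := (le_max_right _ _).trans h
      have h2 : halfIntegral α ≤ ySum α β z := by
        have := monotone_halfIntegral (show α ≤ α - z by linarith [hz.2])
        have := halfIntegral_nonneg (show 0 ≤ β - z by linarith [hz.2])
        unfold ySum; linarith
      have h3 : -Real.sin z ≤ -z := by
        rw [← Real.sin_neg]; exact Real.sin_le (by linarith [hz.2])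
      have h4 := neg_sin_pos hα hz.1 hz.2
      have h5 : halfIntegral α ^ 2 ≤ ySum α β z ^ 2 := pow_le_pow_left₀ hy0.le h2 2
      have h6 : -z * G α β (α - π) ≤ halfIntegral α ^ 2 := by
        rw [← le_div_iff₀ hG0]; linarith
      show G α β (α - π) ≤ ySum α β z ^ 2 / -Real.sin z
      rw [le_div_iff₀ h4]
      nlinarith

/-! ### The critical frame of a c-curve -/

/-- The equation says that the piece of E on one side of the inflection, with directions α - γ and β
- γ, has a chord of the required slope. Its defect ψ satisfies ψ(β) = H(α - β) σ(β) ≤ 0 and, when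
this is strict, ψ(α - π) > 0, so a zero exists by continuity. -/
theorem exists_critical {α β : ℝ} (hα : 0 < α) (hαπ : α < π) (hαβ : α - π < β) (hβ : β < 0)
    (hβα : -α ≤ β) (hσ : sigma α β β ≤ 0) :
    ∃ γ ∈ Ioc (α - π) β, (halfIntegral (α - γ) - halfIntegral (β - γ)) * Real.cos γ =
      -Real.sin γ * (√(Real.sin (α - γ)) - √(Real.sin (β - γ))) := by
  set ψ : ℝ → ℝ := fun γ => (halfIntegral (α - γ) - halfIntegral (β - γ)) * Real.cos γ +
    Real.sin γ * (√(Real.sin (α - γ)) - √(Real.sin (β - γ))) with hψ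
  have hy : 0 < halfIntegral (α - β) := halfIntegral_pos (by linarith) (by linarith)
  have hs : 0 < √(Real.sin (α - β)) :=
    Real.sqrt_pos.2 (Real.sin_pos_of_mem_Ioo ⟨by linarith, by linarith⟩)
  have hψβ : ψ β = halfIntegral (α - β) * Real.cos β + Real.sin β * √(Real.sin (α - β)) := by
    simp [hψ, halfIntegral_zero]
  have hσβ : halfIntegral (α - β) * sigma α β β = ψ β := by
    rw [hψβ]
    simp only [sigma, ySum, sub_self, halfIntegral_zero, Real.sin_zero, Real.sqrt_zero, add_zero]
    field_simp
  suffices ∃ γ ∈ Ioc (α - π) β, ψ γ = 0 by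
    obtain ⟨γ, h1, h2⟩ := this
    refine ⟨γ, h1, ?_⟩
    simp only [hψ] at h2
    linarith
  rcases hσ.lt_or_eq with hlt | heq
  · have hneg : ψ β < 0 := by rw [← hσβ]; exact mul_neg_of_pos_of_neg hy hlt
    have hpos : 0 < ψ (α - π) := by
      have e : ψ (α - π) = -(halfIntegral (α - β) * Real.cos α) +
          Real.sin α * √(Real.sin (α - β)) := by
        simp only [hψ]
        rw [sub_sub_cancel, show β - (α - π) = π - (α - β) by ring, halfIntegral_pi_sub,
          Real.sin_pi_sub, Real.cos_sub_pi, Real.sin_sub_pi, Real.sin_pi]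
        simp
      rw [e]
      rw [hψβ] at hneg
      -- The terms containing the square root cancel in sin α ψ(β) - sin β ψ(α - π) = H(α - β) sin
      -- (α + β) ≥ 0, which is incompatible with ψ(β) < 0 and ψ(α - π) ≤ 0.
      have hsb : 0 < -Real.sin β := by
        rw [← Real.sin_neg]; exact Real.sin_pos_of_mem_Ioo ⟨by linarith, by linarith⟩
      have hsa : 0 < Real.sin α := Real.sin_pos_of_mem_Ioo ⟨hα, hαπ⟩
      have hab : 0 ≤ Real.sin (α + β) :=
        Real.sin_nonneg_of_mem_Icc ⟨by linarith, by linarith⟩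
      rw [Real.sin_add] at hab
      by_contra hle
      push Not at hle
      nlinarith [mul_nonneg hy.le hab, mul_neg_of_neg_of_pos hneg hsa,
        mul_nonneg_of_nonpos_of_nonpos hle (neg_nonpos.2 hsb.le)]
    have hc : ContinuousOn ψ (Icc (α - π) β) := by
      have := continuous_halfIntegral
      simp only [hψ]
      fun_prop
    obtain ⟨γ, hγ, h0⟩ := intermediate_value_Icc' hαβ.le hc ⟨hneg.le, hpos.le⟩
    refine ⟨γ, ⟨lt_of_le_of_ne hγ.1 ?_, hγ.2⟩, h0⟩
    rintro rfl
    linarith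
  · exact ⟨β, ⟨hαβ, le_rfl⟩, by rw [← hσβ, heq, mul_zero]⟩

/-- The angles π - (a + x) and x - b add up to π - (a + b), and the sine is subadditive on [0, π].
-/
theorem sin_le_sin_add_sin {a b x : ℝ} (h1 : b ≤ x) (h2 : x ≤ π - a) (h3 : 0 ≤ a + b) :
    Real.sin (a + b) ≤ Real.sin (a + x) + Real.sin (x - b) := by
  have e1 : Real.sin (a + b) = Real.sin ((π - (a + x)) + (x - b)) := by
    rw [← Real.sin_pi_sub]; congr 1; ring
  have hA : 0 ≤ Real.sin (π - (a + x)) :=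
    Real.sin_nonneg_of_mem_Icc ⟨by linarith, by linarith⟩
  have hB : 0 ≤ Real.sin (x - b) := Real.sin_nonneg_of_mem_Icc ⟨by linarith, by linarith⟩
  rw [e1, Real.sin_add, ← Real.sin_pi_sub (a + x)]
  nlinarith [Real.cos_le_one (x - b), Real.cos_le_one (π - (a + x))]

/-- This is the sign of the derivative needed in `critical_le`. Only cos x > 0 needs work. The
critical equation gives y cos g ≤ sin g √sin (a + g), which eliminates y, and after squaring a
purely trigonometric inequality remains. -/
theorem critical_slope {a b g x y : ℝ} (ha : 0 < a) (hb : 0 < b) (hbg : b ≤ g) (hgx : g ≤ x)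
    (hx : x ≤ π - a) (hy : 0 < y)
    (hcrit : y * Real.cos g = Real.sin g * (√(Real.sin (a + g)) - √(Real.sin (g - b)))) :
    y / √(Real.sin g) * Real.cos x ≤
      (√(Real.sin (a + x)) + √(Real.sin (x - b))) * √(Real.sin x) := by
  have hg0 : 0 < Real.sin g := Real.sin_pos_of_mem_Ioo ⟨by linarith, by linarith⟩
  have hx0 : 0 < Real.sin x := Real.sin_pos_of_mem_Ioo ⟨by linarith, by linarith⟩
  have hA : 0 ≤ Real.sin (a + x) := Real.sin_nonneg_of_mem_Icc ⟨by linarith, by linarith⟩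
  have hB : 0 ≤ Real.sin (x - b) := Real.sin_nonneg_of_mem_Icc ⟨by linarith, by linarith⟩
  have hA0 : 0 ≤ Real.sin (a + g) := Real.sin_nonneg_of_mem_Icc ⟨by linarith, by linarith⟩
  have hM : 0 < y / √(Real.sin g) := by positivity
  rcases le_or_gt (Real.cos x) 0 with hc | hc
  · exact (mul_nonpos_of_nonneg_of_nonpos hM.le hc).trans (by positivity)
  have hxπ : x < π / 2 := by
    by_contra hge
    push Not at hge
    exact hc.not_ge (Real.cos_nonpos_of_pi_div_two_le_of_le hge (by linarith))
  have hcg : 0 < Real.cos g := Real.cos_pos_of_mem_Ioo ⟨by linarith, by linarith⟩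
  have hcos : Real.cos x ≤ Real.cos g :=
    Real.cos_le_cos_of_nonneg_of_le_pi (by linarith) (by linarith) hgx
  have hsin : Real.sin g ≤ Real.sin x :=
    Real.sin_le_sin_of_le_of_le_pi_div_two (by linarith) hxπ.le hgx
  have hdiff : 0 ≤ Real.sin x * Real.cos g - Real.cos x * Real.sin g := by
    rw [← Real.sin_sub]; exact Real.sin_nonneg_of_mem_Icc ⟨by linarith, by linarith⟩
  have hM2 : (y / √(Real.sin g)) ^ 2 * Real.cos g ^ 2 ≤ Real.sin g * Real.sin (a + g) := by
    rw [div_pow, Real.sq_sqrt hg0.le, div_mul_eq_mul_div, div_le_iff₀ hg0, ← mul_pow]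
    have h1 : y * Real.cos g ≤ Real.sin g * √(Real.sin (a + g)) := by
      rw [hcrit]
      exact mul_le_mul_of_nonneg_left (sub_le_self _ (Real.sqrt_nonneg _)) hg0.le
    calc (y * Real.cos g) ^ 2 ≤ (Real.sin g * √(Real.sin (a + g))) ^ 2 :=
          pow_le_pow_left₀ (by positivity) h1 2
      _ = _ := by rw [mul_pow, Real.sq_sqrt hA0]; ring
  -- For cos a ≥ 0 both sin z / cos z and sin (a + z) / cos z = sin a + cos a tan z increase on [g,
  -- x], and the term sin (x - b) can be dropped. For cos a < 0 the second quotient decreases, and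
  -- sin (x - b) makes up for it.
  have hcomp : Real.sin g * Real.sin (a + g) * Real.cos x ^ 2 ≤
      (Real.sin (a + x) + Real.sin (x - b)) * Real.sin x * Real.cos g ^ 2 := by
    rcases le_or_gt 0 (Real.cos a) with hca | hca
    · have e1 : Real.sin g * Real.cos x ≤ Real.sin x * Real.cos g := by linarith
      have e2 : Real.sin (a + g) * Real.cos x ≤ Real.sin (a + x) * Real.cos g := by
        rw [Real.sin_add, Real.sin_add]
        nlinarith [mul_nonneg hca hdiff]
      have e3 : Real.sin (a + g) * Real.cos x * (Real.sin g * Real.cos x) ≤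
          Real.sin (a + x) * Real.cos g * (Real.sin x * Real.cos g) :=
        mul_le_mul e2 e1 (by positivity) (by positivity)
      have e4 : 0 ≤ Real.sin (x - b) * Real.sin x * Real.cos g ^ 2 := by positivity
      linarith
    · have haπ : π / 2 < a := by
        by_contra hle
        push Not at hle
        exact hca.not_ge (Real.cos_nonneg_of_mem_Icc ⟨by linarith, hle⟩)
      have e1 : Real.sin (a + g) ≤ Real.sin (a + b) := by
        rw [← Real.sin_pi_sub, ← Real.sin_pi_sub (a + b)]
        exact Real.sin_le_sin_of_le_of_le_pi_div_two (by linarith) (by linarith) (by linarith)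
      have e2 : Real.sin (a + g) ≤ Real.sin (a + x) + Real.sin (x - b) :=
        e1.trans (sin_le_sin_add_sin (by linarith) hx (by linarith))
      calc Real.sin g * Real.sin (a + g) * Real.cos x ^ 2
          = Real.sin (a + g) * Real.sin g * Real.cos x ^ 2 := by ring
        _ ≤ _ := by gcongr
  refine le_of_sq_le_sq ?_ (by positivity)
  have hR : Real.sin (a + x) + Real.sin (x - b) ≤
      (√(Real.sin (a + x)) + √(Real.sin (x - b))) ^ 2 := by
    have h1 := Real.sq_sqrt hA
    have h2 := Real.sq_sqrt hB
    have h3 : 0 ≤ √(Real.sin (a + x)) * √(Real.sin (x - b)) := by positivity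
    nlinarith
  have hfin : (y / √(Real.sin g)) ^ 2 * Real.cos x ^ 2 ≤
      (Real.sin (a + x) + Real.sin (x - b)) * Real.sin x := by
    have hcg2 : 0 < Real.cos g ^ 2 := by positivity
    refine le_of_mul_le_mul_right ?_ hcg2
    calc (y / √(Real.sin g)) ^ 2 * Real.cos x ^ 2 * Real.cos g ^ 2
        = (y / √(Real.sin g)) ^ 2 * Real.cos g ^ 2 * Real.cos x ^ 2 := by ring
      _ ≤ Real.sin g * Real.sin (a + g) * Real.cos x ^ 2 := by gcongr
      _ ≤ _ := hcomp
  rw [mul_pow, mul_pow, Real.sq_sqrt hx0.le]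
  exact hfin.trans (mul_le_mul_of_nonneg_right hR hx0.le)

/-- An s-curve whose inflection lies beyond the critical frame costs at least as much as the
critical c-curve. -/
theorem critical_le {a b g x : ℝ} (ha : 0 < a) (hb : 0 < b) (hbg : b ≤ g) (hgx : g ≤ x)
    (hx : x ≤ π - a)
    (hcrit : (halfIntegral (a + g) - halfIntegral (g - b)) * Real.cos g =
      Real.sin g * (√(Real.sin (a + g)) - √(Real.sin (g - b)))) :
    (halfIntegral (a + g) - halfIntegral (g - b)) ^ 2 / Real.sin g ≤
      (halfIntegral (a + x) + halfIntegral (x - b)) ^ 2 / Real.sin x := by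
  have hsin : ∀ z ∈ Icc g x, 0 < Real.sin z := fun z hz =>
    Real.sin_pos_of_mem_Ioo ⟨by linarith [hz.1], by linarith [hz.2]⟩
  have hg0 := hsin g ⟨le_rfl, hgx⟩
  have hx0 := hsin x ⟨hgx, le_rfl⟩
  set y := halfIntegral (a + g) - halfIntegral (g - b) with hy
  have hy0 : 0 < y := sub_pos.2 (halfIntegral_lt (by linarith) (by linarith) (by linarith))
  -- Taking square roots, the claim is p x ≥ 0. At the critical angle p g = 2 H(g - b) ≥ 0, and p is
  -- increasing.
  set p : ℝ → ℝ := fun z => halfIntegral (a + z) + halfIntegral (z - b) -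
    y / √(Real.sin g) * √(Real.sin z) with hp
  have hd : ∀ z ∈ Icc g x, HasDerivAt p (1 / 2 * √(Real.sin (a + z)) + 1 / 2 * √(Real.sin (z - b)) -
      y / √(Real.sin g) * (Real.cos z / (2 * √(Real.sin z)))) z := fun z hz =>
    (((hasDerivAt_halfIntegral (a + z)).comp_const_add a z).add
      ((hasDerivAt_halfIntegral (z - b)).comp_sub_const z b)).sub
      (((Real.hasDerivAt_sin z).sqrt (hsin z hz).ne').const_mul _)
  have hmono : MonotoneOn p (Icc g x) := by
    refine monotoneOn_of_deriv_nonneg (convex_Icc g x)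
      (fun z hz => (hd z hz).continuousAt.continuousWithinAt)
      (fun z hz => (hd z (interior_subset hz)).differentiableAt.differentiableWithinAt) fun z hz => ?_
    have hz' := interior_subset hz
    rw [(hd z hz').deriv]
    have h1 := critical_slope ha hb hbg hz'.1 (hz'.2.trans hx) hy0 hcrit
    have h2 : 0 < √(Real.sin z) := Real.sqrt_pos.2 (hsin z hz')
    have h3 : y / √(Real.sin g) * (Real.cos z / (2 * √(Real.sin z))) ≤
        1 / 2 * (√(Real.sin (a + z)) + √(Real.sin (z - b))) := by
      rw [← mul_div_assoc, div_le_iff₀ (by positivity)]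
      linarith
    linarith
  have hpg : 0 ≤ p g := by
    have h1 : √(Real.sin g) ≠ 0 := (Real.sqrt_pos.2 hg0).ne'
    have h2 := halfIntegral_nonneg (sub_nonneg.2 hbg)
    simp only [hp, div_mul_cancel₀ _ h1]
    linarith
  have hpx : 0 ≤ p x := hpg.trans (hmono ⟨le_rfl, hgx⟩ ⟨hgx, le_rfl⟩ hgx)
  have h1 : y / √(Real.sin g) * √(Real.sin x) ≤ halfIntegral (a + x) + halfIntegral (x - b) := by
    simp only [hp] at hpx; linarith
  rw [le_div_iff₀ hx0]
  calc y ^ 2 / Real.sin g * Real.sin x = (y / √(Real.sin g) * √(Real.sin x)) ^ 2 := by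
        rw [mul_pow, div_pow, Real.sq_sqrt hg0.le, Real.sq_sqrt hx0.le]
    _ ≤ _ := pow_le_pow_left₀ (by positivity) h1 2

/-! ### Lower bounds for the energy of s-curves -/

theorem im_exp_mul_of_tangents {α β : ℝ} {q : PlanePath}
    (hq : q ∈ sCurves (UnitTangent.ofAngle 0 α) (UnitTangent.ofAngle 1 β)) (γ : ℝ) :
    (Complex.exp (-γ * Complex.I) * (q.toFun q.right - q.toFun q.left)).im = -Real.sin γ := by
  have h0 : q.toFun q.left = 0 := hq.2.1.1
  have h1 : q.toFun q.right = 1 := hq.2.2.1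
  rw [h0, h1, sub_zero, mul_one, ← Complex.ofReal_neg, Complex.exp_ofReal_mul_I_im, Real.sin_neg]

/-- For a right-left curve the frame is the angle at its inflection. A left-right curve forces β <
0, and there the frame β works: its directions lie in [β, β + π]. -/
theorem exists_G_le_energy {α β : ℝ} (hα : α ∈ Ioc 0 π) (hβ : |β| ≤ α) {q : PlanePath}
    (hq : q ∈ sCurves (UnitTangent.ofAngle 0 α) (UnitTangent.ofAngle 1 β)) :
    ∃ γ ∈ Gam α β, ENNReal.ofReal (G α β γ) ≤ q.energy := by
  obtain ⟨-, h2, θ, m, hm, hθ, hθl, hθr, h⟩ := directions_of_mem_sCurves hα hβ hq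
  have hc := hq.1.isCurve
  rcases h with ⟨hγ, hmem⟩ | ⟨hβ0, -, h4, hmem⟩
  · refine ⟨_, hγ, ?_⟩
    obtain ⟨b1, b2, b3⟩ := mem_Gam_bounds hγ
    have := hθ.ofReal_le_energy hc hm (fun t ht => Real.sin_nonneg_of_mem_Icc
      ⟨sub_nonneg.2 (hmem t ht).1, by linarith [(hmem t ht).2]⟩) (im_exp_mul_of_tangents hq (θ m))
      (neg_sin_pos hα.1 b1 b2)
    rwa [sub_self, halfIntegral_zero, mul_zero, sub_zero, hθl, hθr] at this
  · refine ⟨β, by simp [Gam, hβ0, h2], ?_⟩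
    -- With m at the left end no sign change is made, and H(β - β) = 0 leaves the square of H(α -
    -- β), as in G(β).
    have := hθ.ofReal_le_energy hc (left_mem_Icc.2 hc.lt.le) (γ := β)
      (fun t ht => Real.sin_nonneg_of_mem_Icc
      ⟨sub_nonneg.2 (hmem t ht).1, by linarith [(hmem t ht).2]⟩) (im_exp_mul_of_tangents hq β)
      (neg_sin_pos hα.1 h2 hβ0)
    refine le_trans (le_of_eq ?_) this
    rw [hθl, hθr, G, ySum, sub_self, halfIntegral_zero]
    ring_nf

/-- Curves with all directions in [γ, γ + π] are bounded directly in the critical frame. The others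
pass below γ or above γ + π; they are bounded in the frame of their own inflection, and
`critical_le` compares the two values. -/
theorem critical_le_energy {α β : ℝ} (hα : α ∈ Ioc 0 π) (hβ : |β| ≤ α) (hβ0 : β < 0)
    {γ : ℝ} (hγ : γ ∈ Ioc (α - π) β)
    (hcrit : (halfIntegral (α - γ) - halfIntegral (β - γ)) * Real.cos γ =
      -Real.sin γ * (√(Real.sin (α - γ)) - √(Real.sin (β - γ)))) {q : PlanePath}
    (hq : q ∈ sCurves (UnitTangent.ofAngle 0 α) (UnitTangent.ofAngle 1 β)) :
    ENNReal.ofReal ((halfIntegral (α - γ) - halfIntegral (β - γ)) ^ 2 / -Real.sin γ) ≤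
      q.energy := by
  obtain ⟨-, h2, θ, m, hm, hθ, hθl, hθr, h⟩ := directions_of_mem_sCurves hα hβ hq
  have hc := hq.1.isCurve
  have hγ0 : γ < 0 := hγ.2.trans_lt hβ0
  have frame : (∀ t ∈ Icc q.left q.right, θ t - γ ∈ Icc 0 π) →
      ENNReal.ofReal ((halfIntegral (α - γ) - halfIntegral (β - γ)) ^ 2 / -Real.sin γ) ≤
      q.energy := by
    intro hmem
    have := hθ.ofReal_le_energy hc (left_mem_Icc.2 hc.lt.le)
      (fun t ht => Real.sin_nonneg_of_mem_Icc (hmem t ht)) (im_exp_mul_of_tangents hq γ)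
      (neg_sin_pos hα.1 hγ.1.le hγ0)
    refine le_trans (le_of_eq ?_) this
    rw [hθl, hθr]
    ring_nf
  rcases h with ⟨hm', hmem⟩ | ⟨-, h3, h4, hmem⟩
  · rcases le_or_gt γ (θ m) with hle | hlt
    · exact frame fun t ht => ⟨by linarith [(hmem t ht).1], by linarith [(hmem t ht).2, hγ.1]⟩
    · obtain ⟨b1, b2, b3⟩ := mem_Gam_bounds hm'
      have h5 := hθ.ofReal_le_energy hc hm (fun t ht => Real.sin_nonneg_of_mem_Icc
        ⟨sub_nonneg.2 (hmem t ht).1, by linarith [(hmem t ht).2]⟩) (im_exp_mul_of_tangents hq (θ m))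
        (neg_sin_pos hα.1 b1 b2)
      refine le_trans (ENNReal.ofReal_le_ofReal ?_) h5
      have h6 := critical_le (a := α) (b := -β) (g := -γ) (x := -θ m) hα.1 (by linarith)
        (by linarith [hγ.2]) (by linarith) (by linarith) (by
          rw [Real.cos_neg, Real.sin_neg, ← sub_eq_add_neg, neg_sub_neg]; exact hcrit)
      rw [← sub_eq_add_neg, ← sub_eq_add_neg, neg_sub_neg, neg_sub_neg, Real.sin_neg,
        Real.sin_neg] at h6
      rwa [sub_self, halfIntegral_zero, mul_zero, sub_zero, hθl, hθr]
  · rcases le_or_gt (θ m) (γ + π) with hle | hlt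
    · exact frame fun t ht => ⟨by linarith [(hmem t ht).1, hγ.2], by linarith [(hmem t ht).2]⟩
    · have hs : -Real.sin (θ m - π) = Real.sin (θ m) := by rw [Real.sin_sub_pi, neg_neg]
      have h5 := hθ.ofReal_le_energy hc hm (γ := θ m - π) (fun t ht => Real.sin_nonneg_of_mem_Icc
        ⟨by linarith [(hmem t ht).1], by linarith [(hmem t ht).2]⟩)
        (im_exp_mul_of_tangents hq (θ m - π))
        (neg_sin_pos hα.1 (by linarith) (by linarith))
      refine le_trans (ENNReal.ofReal_le_ofReal ?_) h5
      -- Reversing a left-right curve and reflecting it in the perpendicular bisector of [0, 1]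
      -- negates its angles and exchanges its end points, giving a right-left curve. So -β takes the
      -- role of α, and π + γ that of -γ.
      have hcrit' : (halfIntegral (-β + (π + γ)) - halfIntegral (π + γ - α)) * Real.cos (π + γ) =
          Real.sin (π + γ) * (√(Real.sin (-β + (π + γ))) - √(Real.sin (π + γ - α))) := by
        rw [show -β + (π + γ) = π - (β - γ) by ring, show π + γ - α = π - (α - γ) by ring,
          halfIntegral_pi_sub, halfIntegral_pi_sub, Real.sin_pi_sub, Real.sin_pi_sub,
          add_comm π γ, Real.cos_add_pi, Real.sin_add_pi]
        linarith
      have h6 := critical_le (a := -β) (b := α) (g := π + γ) (x := θ m) (by linarith) hα.1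
        (by linarith [hγ.1]) (by linarith) (by linarith) hcrit'
      rw [hs, hθl, hθr, show α - (θ m - π) = π - (θ m - α) by ring,
        show β - (θ m - π) = π - (θ m - β) by ring, sub_sub_cancel, halfIntegral_pi_sub,
        halfIntegral_pi_sub]
      rw [show -β + (π + γ) = π - (β - γ) by ring, show π + γ - α = π - (α - γ) by ring,
          halfIntegral_pi_sub, halfIntegral_pi_sub, add_comm π γ, Real.sin_add_pi,
          neg_add_eq_sub] at h6
      refine le_trans (le_of_eq ?_) (h6.trans (le_of_eq ?_)) <;> ring_nf

/-! ### Affine images -/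

section Affine

variable (p : PlanePath) {a : ℂ} (b : ℂ)

theorem vel_map_affine (t : ℝ) : (p.map fun z => a * z + b).vel t = a * p.vel t := by
  simp only [PlanePath.vel, PlanePath.map, derivWithin_add_const, derivWithin_const_mul_field]

theorem derivWithin_vel_map_affine (t : ℝ) :
    derivWithin (p.map fun z => a * z + b).vel (Icc p.left p.right) t =
      a * derivWithin p.vel (Icc p.left p.right) t := by
  rw [funext (vel_map_affine p b), derivWithin_const_mul_field]

theorem curvature_map_affine (ha : a ≠ 0) (t : ℝ) :
    (p.map fun z => a * z + b).curvature t = p.curvature t / ‖a‖ := by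
  have h := derivWithin_vel_map_affine p (a := a) b t
  unfold PlanePath.curvature
  rw [vel_map_affine]
  have ha' : ‖a‖ ≠ 0 := norm_ne_zero_iff.2 ha
  have e : conj (a * p.vel t) * (a * derivWithin p.vel (Icc p.left p.right) t) =
      ((‖a‖ ^ 2 : ℝ) : ℂ) * (conj (p.vel t) * derivWithin p.vel (Icc p.left p.right) t) := by
    rw [← Complex.normSq_eq_norm_sq, Complex.normSq_eq_conj_mul_self, map_mul]
    ring
  change (conj (a * p.vel t) * derivWithin _ (Icc p.left p.right) t).im / _ = _
  rw [h, e, Complex.im_ofReal_mul, norm_mul, mul_pow]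
  by_cases hv : p.vel t = 0
  · simp [hv]
  · have hv' : ‖p.vel t‖ ≠ 0 := norm_ne_zero_iff.2 hv
    field_simp

theorem turning_map_affine (ha : a ≠ 0) (s t : ℝ) :
    (p.map fun z => a * z + b).turning s t = p.turning s t := by
  have ha' : ‖a‖ ≠ 0 := norm_ne_zero_iff.2 ha
  unfold PlanePath.turning
  refine intervalIntegral.integral_congr fun x _ => ?_
  show _ * _ = _
  rw [curvature_map_affine p b ha, vel_map_affine, norm_mul]
  field_simp

theorem energy_map_affine (ha : a ≠ 0) :
    (p.map fun z => a * z + b).energy = ENNReal.ofReal ‖a‖⁻¹ * p.energy := by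
  have ha' : ‖a‖ ≠ 0 := norm_ne_zero_iff.2 ha
  unfold PlanePath.energy
  rw [mul_left_comm, ← lintegral_const_mul' _ _ ENNReal.ofReal_ne_top]
  congr 1
  refine lintegral_congr fun x => ?_
  rw [curvature_map_affine p b ha, vel_map_affine, norm_mul,
    ← ENNReal.ofReal_mul (inv_nonneg.2 (norm_nonneg a))]
  congr 1
  field_simp

variable {p}

theorem IsCurve.map_affine (hp : IsCurve p) (ha : a ≠ 0) :
    IsCurve (p.map fun z => a * z + b) where
  lt := hp.lt
  diff := (hp.diff.const_mul a).add_const b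
  ac := by
    rw [funext (vel_map_affine p b)]
    exact hp.ac.const_smul a
  ne t ht := by
    rw [vel_map_affine]
    exact mul_ne_zero ha (hp.ne t ht)

theorem isLeftCOn_map_affine (ha : a ≠ 0) {s t : ℝ} (h : p.IsLeftCOn s t) :
    (p.map fun z => a * z + b).IsLeftCOn s t := by
  refine ⟨?_, by rw [turning_map_affine p b ha]; exact h.2⟩
  filter_upwards [h.1] with x hx
  rw [curvature_map_affine p b ha]
  positivity

theorem isRightCOn_map_affine (ha : a ≠ 0) {s t : ℝ} (h : p.IsRightCOn s t) :
    (p.map fun z => a * z + b).IsRightCOn s t := by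
  refine ⟨?_, by rw [turning_map_affine p b ha]; exact h.2⟩
  filter_upwards [h.1] with x hx
  rw [curvature_map_affine p b ha]
  exact div_nonpos_of_nonpos_of_nonneg hx (norm_nonneg _)

theorem IsCCurve.map_affine (hp : IsCCurve p) (ha : a ≠ 0) :
    IsCCurve (p.map fun z => a * z + b) :=
  ⟨hp.1.map_affine b ha, hp.2.imp (isLeftCOn_map_affine b ha) (isRightCOn_map_affine b ha)⟩

theorem IsSCurve.map_affine (hp : IsSCurve p) (ha : a ≠ 0) :
    IsSCurve (p.map fun z => a * z + b) := by
  rcases hp with hp | ⟨hp, m, hm, h⟩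
  · exact Or.inl (hp.map_affine b ha)
  · exact Or.inr ⟨hp.map_affine b ha, m, hm,
      h.imp (fun h => ⟨isLeftCOn_map_affine b ha h.1, isRightCOn_map_affine b ha h.2⟩)
        (fun h => ⟨isRightCOn_map_affine b ha h.1, isLeftCOn_map_affine b ha h.2⟩)⟩

theorem isTangentAt_map_affine {u u' : UnitTangent} {t : ℝ}
    (hpos : u.pos = a * u'.pos + b) (hdir : u.dir = a / (‖a‖ : ℂ) * u'.dir)
    (h : p.IsTangentAt t u') : (p.map fun z => a * z + b).IsTangentAt t u := by
  refine ⟨?_, ?_⟩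
  · rw [hpos, ← h.1]; rfl
  · rw [hdir, ← h.2, vel_map_affine, norm_mul, Complex.ofReal_mul, mul_div_mul_comm]

end Affine

theorem map_affine_mem_sCurves {a b : ℂ} (ha : a ≠ 0) {u v u' v' : UnitTangent}
    (hu : u.pos = a * u'.pos + b) (hu' : u.dir = a / (‖a‖ : ℂ) * u'.dir)
    (hv : v.pos = a * v'.pos + b) (hv' : v.dir = a / (‖a‖ : ℂ) * v'.dir)
    {p : PlanePath} (hp : p ∈ sCurves u' v') : (p.map fun z => a * z + b) ∈ sCurves u v :=
  ⟨hp.1.map_affine b ha, isTangentAt_map_affine b hu hu' hp.2.1,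
    isTangentAt_map_affine b hv hv' hp.2.2⟩

/-! ### Reflected images -/

section Conj

variable (p : PlanePath)

theorem vel_map_conj (t : ℝ) : (p.map fun z => conj z).vel t = conj (p.vel t) :=
  derivWithin.star

theorem derivWithin_vel_map_conj (t : ℝ) :
    derivWithin (p.map fun z => conj z).vel (Icc p.left p.right) t =
      conj (derivWithin p.vel (Icc p.left p.right) t) := by
  rw [funext (vel_map_conj p)]
  exact derivWithin.star

theorem curvature_map_conj (t : ℝ) : (p.map fun z => conj z).curvature t = -p.curvature t := by
  have h := derivWithin_vel_map_conj p t
  unfold PlanePath.curvature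
  rw [vel_map_conj]
  change (conj (conj (p.vel t)) * derivWithin _ (Icc p.left p.right) t).im / _ = _
  rw [h, ← map_mul, Complex.conj_im, Complex.norm_conj, neg_div]

theorem turning_map_conj (s t : ℝ) : (p.map fun z => conj z).turning s t = -p.turning s t := by
  unfold PlanePath.turning
  rw [← intervalIntegral.integral_neg]
  refine intervalIntegral.integral_congr fun x _ => ?_
  show _ * _ = _
  rw [curvature_map_conj, vel_map_conj, Complex.norm_conj, neg_mul]

theorem energy_map_conj : (p.map fun z => conj z).energy = p.energy := by
  unfold PlanePath.energy
  congr 1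
  refine lintegral_congr fun x => ?_
  rw [curvature_map_conj, vel_map_conj, Complex.norm_conj, neg_sq]

variable {p}

theorem IsCurve.map_conj (hp : IsCurve p) : IsCurve (p.map fun z => conj z) where
  lt := hp.lt
  diff := fun t ht => (hp.diff t ht).star
  ac := by
    rw [funext (vel_map_conj p)]
    refine absolutelyContinuousOnInterval_of_dist_le (K := 1) hp.ac fun x _ y _ => ?_
    rw [dist_eq_norm, dist_eq_norm, ← map_sub, Complex.norm_conj, one_mul]
  ne t ht := by
    rw [vel_map_conj]
    exact (map_ne_zero _).2 (hp.ne t ht)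

theorem isRightCOn_map_conj {s t : ℝ} (h : p.IsLeftCOn s t) :
    (p.map fun z => conj z).IsRightCOn s t := by
  refine ⟨?_, by rw [turning_map_conj]; exact neg_le_neg h.2⟩
  filter_upwards [h.1] with x hx
  rw [curvature_map_conj]
  exact neg_nonpos.2 hx

theorem isLeftCOn_map_conj {s t : ℝ} (h : p.IsRightCOn s t) :
    (p.map fun z => conj z).IsLeftCOn s t := by
  refine ⟨?_, by rw [turning_map_conj]; exact neg_le.1 h.2⟩
  filter_upwards [h.1] with x hx
  rw [curvature_map_conj]
  exact neg_nonneg.2 hx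

theorem IsSCurve.map_conj (hp : IsSCurve p) : IsSCurve (p.map fun z => conj z) := by
  rcases hp with ⟨hp, h⟩ | ⟨hp, m, hm, h⟩
  · exact Or.inl ⟨hp.map_conj, h.symm.imp isLeftCOn_map_conj isRightCOn_map_conj⟩
  · exact Or.inr ⟨hp.map_conj, m, hm,
      h.symm.imp (fun h => ⟨isLeftCOn_map_conj h.1, isRightCOn_map_conj h.2⟩)
        (fun h => ⟨isRightCOn_map_conj h.1, isLeftCOn_map_conj h.2⟩)⟩

theorem isTangentAt_map_conj {u u' : UnitTangent} {t : ℝ}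
    (hpos : u.pos = conj u'.pos) (hdir : u.dir = conj u'.dir)
    (h : p.IsTangentAt t u') : (p.map fun z => conj z).IsTangentAt t u := by
  refine ⟨?_, ?_⟩
  · rw [hpos, ← h.1]; rfl
  · rw [hdir, ← h.2, vel_map_conj, Complex.norm_conj, map_div₀, Complex.conj_ofReal]

end Conj

theorem map_conj_mem_sCurves {u v u' v' : UnitTangent}
    (hu : u.pos = conj u'.pos) (hu' : u.dir = conj u'.dir)
    (hv : v.pos = conj v'.pos) (hv' : v.dir = conj v'.dir)
    {p : PlanePath} (hp : p ∈ sCurves u' v') : (p.map fun z => conj z) ∈ sCurves u v :=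
  ⟨hp.1.map_conj, isTangentAt_map_conj hu hu' hp.2.1, isTangentAt_map_conj hv hv' hp.2.2⟩

/-! ### Reversal -/

section Reverse

/-- On the interval f is a constant plus the integral of its derivative, and the reflection of such
an integral is again one, up to sign and a constant. -/
theorem absolutelyContinuousOnInterval_comp_neg {f : ℝ → ℂ} {a b : ℝ}
    (hf : AbsolutelyContinuousOnInterval f a b) :
    AbsolutelyContinuousOnInterval (fun t => f (-t)) (-b) (-a) := by
  obtain ⟨h1, h2⟩ := ae_hasDerivAt_of_absolutelyContinuousOnInterval hf
  obtain ⟨C, hC⟩ := (hf.sub (absolutelyContinuousOnInterval_integral h2)).const_of_ae_hasDerivAt_zero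
    (by
      filter_upwards [h1, h2.ae_hasDerivAt_integral] with t e1 e2 ht
      simpa using (e1 ht).sub (e2 ht a left_mem_uIcc))
  have h3 : IntervalIntegrable (fun t => deriv f (-t)) volume (-b) (-a) := by
    have := IntervalIntegrable.comp_sub_left h2 0
    simp only [zero_sub] at this
    exact this.symm
  refine absolutelyContinuousOnInterval_of_dist_le (K := 1)
    (absolutelyContinuousOnInterval_integral h3) fun x hx y hy => ?_
  have hneg : ∀ z ∈ uIcc (-b) (-a), -z ∈ uIcc a b := by
    intro z hz
    rw [mem_uIcc] at hz ⊢
    rcases hz with hz | hz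
    · exact Or.inl ⟨by linarith, by linarith⟩
    · exact Or.inr ⟨by linarith, by linarith⟩
  have key : ∀ z ∈ uIcc (-b) (-a), ∫ t in (-b)..z, deriv f (-t) =
      C + (∫ t in a..b, deriv f t) - f (-z) := by
    intro z hz
    have e := hC _ (hneg z hz)
    have hi := intervalIntegral.integral_add_adjacent_intervals
      (h2.mono_set (uIcc_subset_uIcc left_mem_uIcc (hneg z hz)))
      (h2.mono_set (uIcc_subset_uIcc (hneg z hz) right_mem_uIcc))
    rw [intervalIntegral.integral_comp_neg (fun t => deriv f t), neg_neg, ← hi, ← e, Pi.sub_apply]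
    ring
  rw [key x hx, key y hy, one_mul, dist_sub_left]

variable (p : PlanePath)

theorem vel_reverse (t : ℝ) : p.reverse.vel t = -p.vel (-t) := by
  simp only [PlanePath.vel, PlanePath.reverse, derivWithin_comp_neg, neg_Icc, neg_neg]

theorem derivWithin_vel_reverse (t : ℝ) :
    derivWithin p.reverse.vel (Icc p.reverse.left p.reverse.right) t =
      derivWithin p.vel (Icc p.left p.right) (-t) := by
  rw [funext (vel_reverse p), derivWithin.fun_neg, derivWithin_comp_neg p.vel]
  simp [PlanePath.reverse]

theorem curvature_reverse (t : ℝ) : p.reverse.curvature t = -p.curvature (-t) := by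
  unfold PlanePath.curvature
  rw [derivWithin_vel_reverse, vel_reverse, map_neg, neg_mul, Complex.neg_im, norm_neg, neg_div]

theorem turning_reverse (s t : ℝ) : p.reverse.turning (-t) (-s) = -p.turning s t := by
  unfold PlanePath.turning
  simp_rw [curvature_reverse, vel_reverse, norm_neg, neg_mul]
  rw [intervalIntegral.integral_neg,
    intervalIntegral.integral_comp_neg (fun t => p.curvature t * ‖p.vel t‖), neg_neg, neg_neg]

theorem energy_reverse : p.reverse.energy = p.energy := by
  unfold PlanePath.energy
  congr 1
  simp_rw [curvature_reverse, vel_reverse, norm_neg, neg_sq]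
  have h := (Measure.measurePreserving_neg (volume : Measure ℝ)).setLIntegral_comp_preimage_emb
    (MeasurableEquiv.neg ℝ).measurableEmbedding
    (fun t => ENNReal.ofReal (p.curvature t ^ 2 * ‖p.vel t‖)) (Icc p.left p.right)
  rw [← h]
  simp [PlanePath.reverse]

variable {p}

theorem IsCurve.reverse (hp : IsCurve p) : IsCurve p.reverse where
  lt := neg_lt_neg hp.lt
  diff := by
    refine hp.diff.comp differentiable_neg.differentiableOn fun t ht => ?_
    exact ⟨le_neg.1 ht.2, neg_le.1 ht.1⟩
  ac := by
    rw [funext (vel_reverse p)]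
    exact (absolutelyContinuousOnInterval_comp_neg hp.ac).neg
  ne t ht := by
    rw [vel_reverse]
    exact neg_ne_zero.2 (hp.ne _ ⟨le_neg.1 ht.2, neg_le.1 ht.1⟩)

theorem ae_restrict_Icc_neg {P : ℝ → Prop} {s t : ℝ}
    (h : ∀ᵐ x ∂(volume.restrict (Icc s t)), P x) :
    ∀ᵐ x ∂(volume.restrict (Icc (-t) (-s))), P (-x) := by
  rw [ae_restrict_iff' measurableSet_Icc] at h ⊢
  filter_upwards [(Measure.measurePreserving_neg (volume : Measure ℝ)).quasiMeasurePreserving.ae h]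
    with x hx hm
  exact hx ⟨le_neg.1 hm.2, neg_le.1 hm.1⟩

theorem isRightCOn_reverse {s t : ℝ} (h : p.IsLeftCOn s t) : p.reverse.IsRightCOn (-t) (-s) := by
  refine ⟨?_, by rw [turning_reverse]; exact neg_le_neg h.2⟩
  filter_upwards [ae_restrict_Icc_neg h.1] with x hx
  rw [curvature_reverse]
  exact neg_nonpos.2 hx

theorem isLeftCOn_reverse {s t : ℝ} (h : p.IsRightCOn s t) : p.reverse.IsLeftCOn (-t) (-s) := by
  refine ⟨?_, by rw [turning_reverse]; exact neg_le.1 h.2⟩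
  filter_upwards [ae_restrict_Icc_neg h.1] with x hx
  rw [curvature_reverse]
  exact neg_nonneg.2 hx

theorem IsSCurve.reverse (hp : IsSCurve p) : IsSCurve p.reverse := by
  rcases hp with ⟨hp, h⟩ | ⟨hp, m, hm, h⟩
  · exact Or.inl ⟨hp.reverse, h.symm.imp isLeftCOn_reverse isRightCOn_reverse⟩
  · exact Or.inr ⟨hp.reverse, -m, ⟨neg_lt_neg hm.2, neg_lt_neg hm.1⟩,
      h.imp (fun h => ⟨isLeftCOn_reverse h.2, isRightCOn_reverse h.1⟩)
        (fun h => ⟨isRightCOn_reverse h.2, isLeftCOn_reverse h.1⟩)⟩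

theorem isTangentAt_reverse {u u' : UnitTangent} {t : ℝ} (hpos : u.pos = u'.pos)
    (hdir : u.dir = -u'.dir) (h : p.IsTangentAt t u') : p.reverse.IsTangentAt (-t) u := by
  refine ⟨?_, ?_⟩
  · rw [hpos, ← h.1]; simp [PlanePath.reverse]
  · rw [hdir, ← h.2, vel_reverse, neg_neg, norm_neg, neg_div]

end Reverse

theorem reverse_mem_sCurves {u v u' v' : UnitTangent}
    (hu : u.pos = v'.pos) (hu' : u.dir = -v'.dir) (hv : v.pos = u'.pos) (hv' : v.dir = -u'.dir)
    {p : PlanePath} (hp : p ∈ sCurves u' v') : p.reverse ∈ sCurves u v :=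
  ⟨hp.1.reverse, isTangentAt_reverse hu hu' hp.2.2, isTangentAt_reverse hv hv' hp.2.1⟩

/-! ### Derivatives of the elastica -/

/-- `√(1 + sin² t)`, the reciprocal of the speed of the elastica. -/
noncomputable def slowness (t : ℝ) : ℝ := √(1 + Real.sin t ^ 2)

theorem slowness_pos (t : ℝ) : 0 < slowness t := Real.sqrt_pos.2 (by positivity)

theorem slowness_sq (t : ℝ) : slowness t ^ 2 = 1 + Real.sin t ^ 2 := Real.sq_sqrt (by positivity)

theorem hasDerivAt_slowness (t : ℝ) :
    HasDerivAt slowness (Real.sin t * Real.cos t / slowness t) t := by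
  have h := (((Real.hasDerivAt_sin t).pow 2).const_add 1).sqrt
    (show (1 : ℝ) + Real.sin t ^ 2 ≠ 0 by positivity)
  refine h.congr_deriv ?_
  have := (slowness_pos t).ne'
  unfold slowness at this ⊢
  simp only [Pi.pow_apply]
  field_simp
  push_cast
  ring

theorem continuous_slowness : Continuous slowness := by unfold slowness; fun_prop

/-- The velocity of the elastica. -/
noncomputable def elasticaVel (t : ℝ) : ℂ :=
  (Real.cos t : ℂ) + ((Real.sin t ^ 2 / slowness t : ℝ) : ℂ) * Complex.I

/-- The second derivative of the elastica. -/
noncomputable def elasticaAcc (t : ℝ) : ℂ :=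
  ((-Real.sin t : ℝ) : ℂ) +
    ((Real.sin t * Real.cos t * (2 + Real.sin t ^ 2) / slowness t ^ 3 : ℝ) : ℂ) * Complex.I

/-- The direction angle of the elastica. -/
noncomputable def elasticaAngle (t : ℝ) : ℝ := ∫ r in (0 : ℝ)..t, 2 * Real.sin r / slowness r

theorem hasDerivAt_xi (t : ℝ) : HasDerivAt xi (Real.sin t ^ 2 / slowness t) t := by
  have hc : Continuous fun r : ℝ => Real.sin r ^ 2 / slowness r :=
    (by fun_prop : Continuous fun r : ℝ => Real.sin r ^ 2).div continuous_slowness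
      fun r => (slowness_pos r).ne'
  exact (hc.integral_hasStrictDerivAt 0 t).hasDerivAt

theorem hasDerivAt_elasticaAngle (t : ℝ) :
    HasDerivAt elasticaAngle (2 * Real.sin t / slowness t) t := by
  have hc : Continuous fun r : ℝ => 2 * Real.sin r / slowness r :=
    (by fun_prop : Continuous fun r : ℝ => 2 * Real.sin r).div continuous_slowness
      fun r => (slowness_pos r).ne'
  exact (hc.integral_hasStrictDerivAt 0 t).hasDerivAt

theorem hasDerivAt_elastica (t : ℝ) : HasDerivAt elastica (elasticaVel t) t :=
  (Real.hasDerivAt_sin t).ofReal_comp.add ((hasDerivAt_xi t).ofReal_comp.mul_const Complex.I)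

theorem hasDerivAt_elasticaVel (t : ℝ) : HasDerivAt elasticaVel (elasticaAcc t) t := by
  have h : HasDerivAt (fun t => Real.sin t ^ 2 / slowness t)
      (Real.sin t * Real.cos t * (2 + Real.sin t ^ 2) / slowness t ^ 3) t := by
    refine (((Real.hasDerivAt_sin t).pow 2).div (hasDerivAt_slowness t)
      (slowness_pos t).ne').congr_deriv ?_
    have h1 := (slowness_pos t).ne'
    have h2 := slowness_sq t
    simp only [Pi.pow_apply]
    field_simp
    rw [h2]
    push_cast
    ring
  exact (Real.hasDerivAt_cos t).ofReal_comp.add (h.ofReal_comp.mul_const Complex.I)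

theorem elasticaAngle_zero : elasticaAngle 0 = 0 := by simp [elasticaAngle]

/-- The product z of velocity and slowness solves z' = i φ' z with z(0) = 1, where φ is the
direction angle, so z = e^{iφ}. -/
theorem elasticaVel_eq (t : ℝ) :
    elasticaVel t = ((slowness t)⁻¹ : ℝ) * Complex.exp (elasticaAngle t * Complex.I) := by
  set z : ℝ → ℂ := fun t => ((Real.cos t * slowness t : ℝ) : ℂ) + ((Real.sin t ^ 2 : ℝ) : ℂ) * Complex.I
    with hz
  have hd : ∀ t, HasDerivAt (fun t => z t * Complex.exp (-(elasticaAngle t * Complex.I))) 0 t := by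
    intro t
    have h1 : HasDerivAt z ((2 * Real.sin t / slowness t : ℝ) * Complex.I * z t) t := by
      have e1 := ((Real.hasDerivAt_cos t).mul (hasDerivAt_slowness t)).ofReal_comp.add
        (((Real.hasDerivAt_sin t).pow 2).ofReal_comp.mul_const Complex.I)
      refine e1.congr_deriv ?_
      have h1 := (slowness_pos t).ne'
      have h2 := slowness_sq t
      have h3 := Real.sin_sq_add_cos_sq t
      apply Complex.ext
      · simp [hz, -Complex.ofReal_sin, -Complex.ofReal_cos, -Complex.ofReal_pow]
        field_simp
        rw [h2]
        linear_combination Real.sin t * h3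
      · simp [hz, -Complex.ofReal_sin, -Complex.ofReal_cos, -Complex.ofReal_pow]
        field_simp
    have h2 := (((hasDerivAt_elasticaAngle t).ofReal_comp.mul_const Complex.I).neg).cexp
    refine (h1.mul h2).congr_deriv ?_
    ring
  have hconst := is_const_of_deriv_eq_zero (fun t => (hd t).differentiableAt)
    (fun t => (hd t).deriv) t 0
  have h0 : z 0 * Complex.exp (-(elasticaAngle 0 * Complex.I)) = 1 := by
    simp [hz, elasticaAngle_zero, slowness]
  rw [h0] at hconst
  have h3 : z t = Complex.exp (elasticaAngle t * Complex.I) := by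
    rw [Complex.exp_neg] at hconst
    have := Complex.exp_ne_zero (elasticaAngle t * Complex.I)
    field_simp at hconst
    exact hconst
  rw [← h3]
  have h1 := (slowness_pos t).ne'
  have h1' : (slowness t : ℂ) ≠ 0 := by exact_mod_cast h1
  simp only [elasticaVel, hz]
  push_cast
  field_simp

theorem norm_elasticaVel (t : ℝ) : ‖elasticaVel t‖ = (slowness t)⁻¹ := by
  rw [elasticaVel_eq, norm_mul, Complex.norm_exp_ofReal_mul_I, mul_one, Complex.norm_real,
    Real.norm_of_nonneg (inv_nonneg.2 (slowness_pos t).le)]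

theorem elasticaVel_ne_zero (t : ℝ) : elasticaVel t ≠ 0 := by
  rw [← norm_pos_iff, norm_elasticaVel]
  exact inv_pos.2 (slowness_pos t)

/-- Together with κ = 2 sin t this gives |κ| = 2 √sin φ for the direction angle φ, which is the
equality case of the energy bound. -/
theorem sin_elasticaAngle (t : ℝ) : Real.sin (elasticaAngle t) = Real.sin t ^ 2 := by
  have h := congrArg Complex.im (elasticaVel_eq t)
  rw [Complex.im_ofReal_mul, Complex.exp_ofReal_mul_I_im] at h
  have h1 := (slowness_pos t).ne'
  simp [elasticaVel, -Complex.ofReal_sin, -Complex.ofReal_cos, -Complex.ofReal_pow,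
    -Complex.ofReal_div] at h
  field_simp at h
  exact h.symm

theorem cos_elasticaAngle (t : ℝ) :
    Real.cos (elasticaAngle t) = Real.cos t * slowness t := by
  have h := congrArg Complex.re (elasticaVel_eq t)
  rw [Complex.re_ofReal_mul, Complex.exp_ofReal_mul_I_re] at h
  have h1 := (slowness_pos t).ne'
  simp [elasticaVel, -Complex.ofReal_sin, -Complex.ofReal_cos, -Complex.ofReal_pow,
    -Complex.ofReal_div] at h
  field_simp at h
  exact h.symm

theorem elastica_curvature (t : ℝ) :
    (conj (elasticaVel t) * elasticaAcc t).im / ‖elasticaVel t‖ ^ 3 = 2 * Real.sin t := by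
  rw [norm_elasticaVel]
  have h1 := (slowness_pos t).ne'
  have h2 := slowness_sq t
  have h3 : Real.cos t ^ 2 = 1 - Real.sin t ^ 2 := by linarith [Real.sin_sq_add_cos_sq t]
  simp [elasticaVel, elasticaAcc, -Complex.ofReal_sin, -Complex.ofReal_cos, -Complex.ofReal_pow,
    -Complex.ofReal_div, -Complex.ofReal_mul, -Complex.ofReal_neg, -Complex.ofReal_add]
  field_simp
  rw [h2, h3]
  ring

theorem monotoneOn_elasticaAngle : MonotoneOn elasticaAngle (Icc 0 π) := by
  refine monotoneOn_of_deriv_nonneg (convex_Icc 0 π)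
    (fun t _ => (hasDerivAt_elasticaAngle t).continuousAt.continuousWithinAt)
    (fun t _ => (hasDerivAt_elasticaAngle t).differentiableAt.differentiableWithinAt) fun t ht => ?_
  rw [(hasDerivAt_elasticaAngle t).deriv]
  exact div_nonneg (mul_nonneg zero_le_two (Real.sin_nonneg_of_mem_Icc (interior_subset ht)))
    (slowness_pos t).le

theorem continuous_elasticaAngle : Continuous elasticaAngle :=
  continuous_iff_continuousAt.2 fun t => (hasDerivAt_elasticaAngle t).continuousAt

/-- The cosine of the end angle is -1. The angle cannot pass beyond π, because it would then take,
by continuity, values with negative sine, whereas its sine is a square. -/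
theorem elasticaAngle_pi : elasticaAngle π = π := by
  have hπ := Real.pi_pos
  have h0 : 0 ≤ elasticaAngle π := by
    have := monotoneOn_elasticaAngle ⟨le_rfl, hπ.le⟩ ⟨hπ.le, le_rfl⟩ hπ.le
    rwa [elasticaAngle_zero] at this
  have hcos : Real.cos (elasticaAngle π) = -1 := by rw [cos_elasticaAngle]; simp [slowness]
  by_contra hne
  rcases lt_or_gt_of_ne hne with hlt | hgt
  · have := Real.strictAntiOn_cos ⟨h0, hlt.le⟩ ⟨hπ.le, le_rfl⟩ hlt
    rw [hcos, Real.cos_pi] at this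
    exact lt_irrefl _ this
  · set y := min (elasticaAngle π) (3 * π / 2) with hy
    have hy1 : π < y := lt_min hgt (by linarith)
    have hy2 : y ≤ elasticaAngle π := min_le_left _ _
    have hy3 : y ≤ 3 * π / 2 := min_le_right _ _
    obtain ⟨t, _, ht⟩ := intermediate_value_Icc hπ.le continuous_elasticaAngle.continuousOn
      (show y ∈ Icc (elasticaAngle 0) (elasticaAngle π) from
        ⟨by rw [elasticaAngle_zero]; linarith, hy2⟩)
    have hsin : 0 ≤ Real.sin y := by rw [← ht, sin_elasticaAngle]; positivity
    have : Real.sin y < 0 := by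
      rw [← neg_pos, ← Real.sin_sub_pi]
      exact Real.sin_pos_of_mem_Ioo ⟨by linarith, by linarith⟩
    linarith

theorem elasticaAngle_neg (t : ℝ) : elasticaAngle (-t) = elasticaAngle t := by
  have h := intervalIntegral.integral_comp_neg (a := 0) (b := t)
    (fun r => 2 * Real.sin r / slowness r)
  simp only [neg_zero, Real.sin_neg, slowness, neg_sq] at h
  unfold elasticaAngle
  rw [intervalIntegral.integral_symm]
  simp only [slowness]
  rw [← h, ← intervalIntegral.integral_neg]
  refine intervalIntegral.integral_congr fun r _ => ?_
  show -(2 * -Real.sin r / _) = _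
  ring

theorem xi_neg (t : ℝ) : xi (-t) = -xi t := by
  have h := intervalIntegral.integral_comp_neg (a := 0) (b := t)
    (fun r => Real.sin r ^ 2 / √(1 + Real.sin r ^ 2))
  simp only [neg_zero, Real.sin_neg, neg_sq] at h
  unfold xi
  rw [intervalIntegral.integral_symm, ← h]

theorem elastica_neg (t : ℝ) : elastica (-t) = -elastica t := by
  simp only [elastica, xi_neg, Real.sin_neg]
  push_cast
  ring

theorem xi_zero : xi 0 = 0 := by simp [xi]

/-- On [0, π] the root of sin φ = sin² t is sin t, and both sides have the same derivative. Height,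
bending energy and H therefore agree along E. -/
theorem xi_eq_halfIntegral {t : ℝ} (ht : t ∈ Icc 0 π) : xi t = halfIntegral (elasticaAngle t) := by
  have hd : ∀ s ∈ Icc 0 π, HasDerivAt (fun s => xi s - halfIntegral (elasticaAngle s)) 0 s := by
    intro s hs
    refine ((hasDerivAt_xi s).sub ((hasDerivAt_halfIntegral (elasticaAngle s)).comp s
      (hasDerivAt_elasticaAngle s))).congr_deriv ?_
    rw [sin_elasticaAngle, Real.sqrt_sq (Real.sin_nonneg_of_mem_Icc hs)]
    ring
  have := constant_of_has_deriv_right_zero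
    (fun s hs => (hd s hs).continuousAt.continuousWithinAt)
    (fun s hs => (hd s (Ico_subset_Icc_self hs)).hasDerivWithinAt) t ht
  rw [xi_zero, elasticaAngle_zero, halfIntegral_zero] at this
  linarith

theorem elasticaAngle_mem {t : ℝ} (ht : t ∈ Icc 0 π) : elasticaAngle t ∈ Icc 0 π := by
  have h1 := monotoneOn_elasticaAngle ⟨le_rfl, Real.pi_pos.le⟩ ht ht.1
  have h2 := monotoneOn_elasticaAngle ht ⟨Real.pi_pos.le, le_rfl⟩ ht.2
  rw [elasticaAngle_zero] at h1
  rw [elasticaAngle_pi] at h2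
  exact ⟨h1, h2⟩

/-- The point of the elastica with a given direction. -/
theorem exists_elasticaAngle_eq {φ : ℝ} (hφ : φ ∈ Icc 0 π) : ∃ t ∈ Icc 0 π,
    elasticaAngle t = φ ∧ Real.sin t = √(Real.sin φ) ∧ xi t = halfIntegral φ := by
  obtain ⟨t, ht, h⟩ := intermediate_value_Icc Real.pi_pos.le continuous_elasticaAngle.continuousOn
    (show φ ∈ Icc (elasticaAngle 0) (elasticaAngle π) by
      rwa [elasticaAngle_zero, elasticaAngle_pi])
  refine ⟨t, ht, h, ?_, ?_⟩
  · rw [← h, sin_elasticaAngle, Real.sqrt_sq (Real.sin_nonneg_of_mem_Icc ht)]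
  · rw [xi_eq_halfIntegral ht, h]

/-! ### Elastica arcs with an inserted line segment -/

/-- The elastica parameter of the point with parameter `s` on an elastica with a segment of length
`c` inserted at the inflection. -/
noncomputable def elasticaParam (c s : ℝ) : ℝ := min s 0 + max (s - c) 0

/-- Stopping F at 0 keeps it differentiable because F' vanishes there; applied to the elastica, this
is where the inflection is used to insert a segment smoothly. -/
theorem hasDerivAt_comp_min {E : Type*} [NormedAddCommGroup E] [NormedSpace ℝ E] {F F' : ℝ → E}
    (hF : ∀ x, HasDerivAt F (F' x) x) (h0 : F' 0 = 0) (s : ℝ) :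
    HasDerivAt (fun s => F (min s 0)) (F' (min s 0)) s := by
  have h1 : ∀ s ≤ 0, HasDerivWithinAt (fun s => F (min s 0)) (F' (min s 0)) (Iic 0) s := by
    intro s hs
    rw [min_eq_left hs]
    exact (hF s).hasDerivWithinAt.congr (fun x hx => by rw [min_eq_left hx]) (by rw [min_eq_left hs])
  have h2 : ∀ s, 0 ≤ s → HasDerivWithinAt (fun s => F (min s 0)) (F' (min s 0)) (Ici 0) s := by
    intro s hs
    rw [min_eq_right hs, h0]
    exact (hasDerivWithinAt_const s _ (F 0)).congr (fun x hx => by rw [min_eq_right hx])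
      (by rw [min_eq_right hs])
  rcases lt_trichotomy s 0 with h | rfl | h
  · exact (h1 s h.le).hasDerivAt (Iic_mem_nhds h)
  · have := (h1 0 le_rfl).union (h2 0 le_rfl)
    rwa [Iic_union_Ici, hasDerivWithinAt_univ] at this
  · exact (h2 s h.le).hasDerivAt (Ici_mem_nhds h)

theorem hasDerivAt_comp_elasticaParam {E : Type*} [NormedAddCommGroup E] [NormedSpace ℝ E]
    {F F' : ℝ → E} (hF : ∀ x, HasDerivAt F (F' x) x) (h0 : F' 0 = 0) {c : ℝ} (hc : 0 ≤ c) (s : ℝ) :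
    HasDerivAt (fun s => F (elasticaParam c s)) (F' (elasticaParam c s)) s := by
  have h1 := hasDerivAt_comp_min hF h0 s
  -- The part after the segment follows by symmetry, since max (s - c) 0 = -min (c - s) 0.
  have h2 := (hasDerivAt_comp_min (F := fun x => F (-x)) (F' := fun x => -F' (-x))
    (fun x => by
      have h := (hF (-x)).scomp x (hasDerivAt_neg x)
      rw [neg_smul, one_smul] at h
      exact h) (by simpa using h0)
    (c - s)).comp_const_sub c s
  have hmm : ∀ s, -min (c - s) 0 = max (s - c) 0 := fun s => by
    rw [← max_neg_neg, neg_sub, neg_zero]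
  simp only [hmm, neg_neg] at h2
  have h3 := (h1.add h2).sub_const (F 0)
  have e1 : ∀ s, F (elasticaParam c s) = F (min s 0) + F (max (s - c) 0) - F 0 := by
    intro s
    unfold elasticaParam
    rcases le_total s 0 with h | h
    · rw [max_eq_right (by linarith)]; simp
    · rw [min_eq_right h]; simp
  have e2 : F' (elasticaParam c s) = F' (min s 0) + F' (max (s - c) 0) := by
    unfold elasticaParam
    rcases le_total s 0 with h | h
    · rw [max_eq_right (by linarith)]; simp [h0]
    · rw [min_eq_right h]; simp [h0]
  rw [e2]
  exact h3.congr_of_eventuallyEq (Filter.Eventually.of_forall e1)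

theorem continuous_elasticaParam (c : ℝ) : Continuous (elasticaParam c) := by
  unfold elasticaParam; fun_prop

theorem elasticaParam_mem_Icc_neg {c s : ℝ} (hc : 0 ≤ c) (hs : s ∈ Icc (-π) 0) :
    elasticaParam c s = s := by
  rw [elasticaParam, min_eq_left hs.2, max_eq_right (by linarith [hs.2]), add_zero]

theorem elasticaParam_mem_Icc {c s : ℝ} (hs : s ∈ Icc 0 (c + π)) :
    elasticaParam c s ∈ Icc 0 π := by
  rw [elasticaParam, min_eq_right hs.1, zero_add]
  exact ⟨le_max_right _ _, max_le (by linarith [hs.2]) Real.pi_pos.le⟩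

theorem elasticaParam_add {c t : ℝ} (hc : 0 ≤ c) (ht : 0 ≤ t) : elasticaParam c (c + t) = t := by
  rw [elasticaParam, min_eq_right (by linarith), add_sub_cancel_left, max_eq_left ht, zero_add]

theorem elasticaParam_zero_left (s : ℝ) : elasticaParam 0 s = s := by
  rw [elasticaParam, sub_zero]
  exact min_add_max s 0 |>.trans (add_zero s)

/-- The arc over `[l, r]` of the elastica with a segment of length `c` inserted at the
inflection. -/
noncomputable def uturnArc (c l r : ℝ) : PlanePath :=
  ⟨l, r, fun s => elastica (elasticaParam c s) + ((s - elasticaParam c s : ℝ) : ℂ)⟩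

theorem elastica_zero : elastica 0 = 0 := by simp [elastica, xi_zero]

theorem elasticaSegment_eq (a b : ℝ) : elasticaSegment a b = uturnArc 0 a b := by
  simp [elasticaSegment, uturnArc, elasticaParam_zero_left]

theorem uturnPath_eq {c : ℝ} (hc : 0 ≤ c) (t : ℝ) : uturnPath c t = uturnArc c (-π) (c + t) := by
  unfold uturnPath uturnArc
  congr 1
  funext s
  unfold elasticaParam
  split_ifs with h1 h2
  · rw [min_eq_left h1, max_eq_right (by linarith)]; simp
  · push Not at h1
    rw [min_eq_right h1.le, max_eq_right (by linarith)]; simp [elastica_zero]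
  · push Not at h1 h2
    rw [min_eq_right h1.le, max_eq_left (by linarith), zero_add, sub_sub_cancel, add_comm]

section Arc

variable {c l r : ℝ}

theorem hasDerivAt_uturnArc (hc : 0 ≤ c) (s : ℝ) :
    HasDerivAt (uturnArc c l r).toFun (elasticaVel (elasticaParam c s)) s := by
  have h1 := hasDerivAt_comp_elasticaParam (F := fun x => elastica x - (x : ℂ))
    (F' := fun x => elasticaVel x - 1)
    (fun x => (hasDerivAt_elastica x).sub (hasDerivAt_id x).ofReal_comp)
    (by simp [elasticaVel]) hc s
  refine ((h1.add (hasDerivAt_id s).ofReal_comp).congr_deriv (by simp)).congr_of_eventuallyEq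
    (Filter.Eventually.of_forall fun x => ?_)
  simp only [uturnArc, Pi.add_apply, id, Complex.ofReal_sub]
  ring

theorem hasDerivAt_elasticaVel_elasticaParam (hc : 0 ≤ c) (s : ℝ) :
    HasDerivAt (fun s => elasticaVel (elasticaParam c s)) (elasticaAcc (elasticaParam c s)) s :=
  hasDerivAt_comp_elasticaParam hasDerivAt_elasticaVel (by simp [elasticaAcc]) hc s

theorem vel_uturnArc (hc : 0 ≤ c) (hlr : l < r) {s : ℝ} (hs : s ∈ Icc l r) :
    (uturnArc c l r).vel s = elasticaVel (elasticaParam c s) :=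
  (hasDerivAt_uturnArc hc s).hasDerivWithinAt.derivWithin (uniqueDiffOn_Icc hlr s hs)

theorem derivWithin_vel_uturnArc (hc : 0 ≤ c) (hlr : l < r) {s : ℝ} (hs : s ∈ Icc l r) :
    derivWithin (uturnArc c l r).vel (Icc l r) s = elasticaAcc (elasticaParam c s) := by
  rw [derivWithin_congr (fun x hx => vel_uturnArc hc hlr hx) (vel_uturnArc hc hlr hs)]
  exact (hasDerivAt_elasticaVel_elasticaParam hc s).hasDerivWithinAt.derivWithin
    (uniqueDiffOn_Icc hlr s hs)

theorem curvature_uturnArc (hc : 0 ≤ c) (hlr : l < r) {s : ℝ} (hs : s ∈ Icc l r) :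
    (uturnArc c l r).curvature s = 2 * Real.sin (elasticaParam c s) := by
  have h := derivWithin_vel_uturnArc hc hlr hs
  unfold PlanePath.curvature
  change (conj ((uturnArc c l r).vel s) * derivWithin (uturnArc c l r).vel (Icc l r) s).im / _ = _
  rw [h, vel_uturnArc hc hlr hs, elastica_curvature]

theorem continuous_elasticaAcc : Continuous elasticaAcc := by
  have h : Continuous fun t => Real.sin t * Real.cos t * (2 + Real.sin t ^ 2) / slowness t ^ 3 :=
    (by fun_prop : Continuous fun t : ℝ => Real.sin t * Real.cos t * (2 + Real.sin t ^ 2)).div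
      (continuous_slowness.pow 3) fun t => (pow_pos (slowness_pos t) 3).ne'
  have h2 : Continuous fun t : ℝ => -Real.sin t := by fun_prop
  exact (Complex.continuous_ofReal.comp h2).add
    ((Complex.continuous_ofReal.comp h).mul continuous_const)

theorem isCurve_uturnArc (hc : 0 ≤ c) (hlr : l < r) : IsCurve (uturnArc c l r) where
  lt := hlr
  diff := fun s _ => (hasDerivAt_uturnArc hc s).differentiableAt.differentiableWithinAt
  ac := by
    have hi : ∀ a b, IntervalIntegrable (fun s => elasticaAcc (elasticaParam c s)) volume a b :=
      fun a b => (continuous_elasticaAcc.comp (continuous_elasticaParam c)).intervalIntegrable a b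
    refine absolutelyContinuousOnInterval_of_dist_le (K := 1)
      (absolutelyContinuousOnInterval_integral (hi l r)) fun x hx y hy => ?_
    change x ∈ uIcc l r at hx
    change y ∈ uIcc l r at hy
    rw [uIcc_of_le hlr.le] at hx hy
    have key : ∀ z, ∫ s in l..z, elasticaAcc (elasticaParam c s) =
        elasticaVel (elasticaParam c z) - elasticaVel (elasticaParam c l) := fun z =>
      intervalIntegral.integral_eq_sub_of_hasDerivAt
        (fun s _ => hasDerivAt_elasticaVel_elasticaParam hc s) (hi l z)
    show _ ≤ 1 * dist (∫ s in l..x, elasticaAcc (elasticaParam c s))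
      (∫ s in l..y, elasticaAcc (elasticaParam c s))
    rw [key, key, vel_uturnArc hc hlr hx, vel_uturnArc hc hlr hy, one_mul, dist_sub_right]
  ne s hs := by
    rw [vel_uturnArc hc hlr hs]
    exact elasticaVel_ne_zero _

theorem turning_uturnArc (hc : 0 ≤ c) (hlr : l < r) {a b : ℝ} (ha : a ∈ Icc l r)
    (hb : b ∈ Icc l r) : (uturnArc c l r).turning a b =
      elasticaAngle (elasticaParam c b) - elasticaAngle (elasticaParam c a) := by
  have hcont : Continuous fun s => 2 * Real.sin (elasticaParam c s) / slowness (elasticaParam c s) := by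
    have := continuous_elasticaParam c
    exact (by fun_prop : Continuous fun s => 2 * Real.sin (elasticaParam c s)).div
      (continuous_slowness.comp this) fun s => (slowness_pos _).ne'
  rw [← intervalIntegral.integral_eq_sub_of_hasDerivAt
    (fun s _ => hasDerivAt_comp_elasticaParam hasDerivAt_elasticaAngle (by simp) hc s)
    (hcont.intervalIntegrable a b)]
  refine intervalIntegral.integral_congr fun s hs => ?_
  have hs' := uIcc_subset_Icc ha hb hs
  show _ * _ = _
  rw [curvature_uturnArc hc hlr hs', vel_uturnArc hc hlr hs', norm_elasticaVel, div_eq_mul_inv]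

/-- The integrand κ² ‖vel‖ / 4 equals sin² / slowness, the derivative of ξ along the arc; it
vanishes on the segment. -/
theorem energy_uturnArc (hc : 0 ≤ c) (hlr : l < r) : (uturnArc c l r).energy =
    ENNReal.ofReal (xi (elasticaParam c r) - xi (elasticaParam c l)) := by
  have hcont : Continuous fun s => Real.sin (elasticaParam c s) ^ 2 / slowness (elasticaParam c s) := by
    have := continuous_elasticaParam c
    exact (by fun_prop : Continuous fun s => Real.sin (elasticaParam c s) ^ 2).div
      (continuous_slowness.comp this) fun s => (slowness_pos _).ne'
  have h1 := intervalIntegral.integral_eq_sub_of_hasDerivAt (a := l) (b := r)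
    (fun s _ => hasDerivAt_comp_elasticaParam hasDerivAt_xi (by simp) hc s)
    (hcont.intervalIntegrable l r)
  rw [intervalIntegral.integral_of_le hlr.le, ← integral_Icc_eq_integral_Ioc] at h1
  unfold PlanePath.energy
  rw [← h1, ofReal_integral_eq_lintegral_ofReal hcont.integrableOn_Icc
    (Filter.Eventually.of_forall fun s => div_nonneg (sq_nonneg _) (slowness_pos _).le)]
  change 1 / 4 * ∫⁻ t in Icc l r, _ = _
  rw [← lintegral_const_mul' _ _ (by simp)]
  refine setLIntegral_congr_fun measurableSet_Icc fun s hs => ?_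
  show 1 / 4 * ENNReal.ofReal _ = _
  rw [curvature_uturnArc hc hlr hs, vel_uturnArc hc hlr hs, norm_elasticaVel]
  have h4 : (1 / 4 : ℝ≥0∞) = ENNReal.ofReal (1 / 4) := by
    rw [ENNReal.ofReal_div_of_pos (by norm_num)]; simp
  rw [h4, ← ENNReal.ofReal_mul (by norm_num)]
  congr 1
  rw [div_eq_mul_inv (Real.sin _ ^ 2)]
  ring

theorem isRightCOn_uturnArc (hc : 0 ≤ c) (hlr : l < r) {a b : ℝ} (ha : a ∈ Icc l r)
    (hb : b ∈ Icc l r) (h1 : -π ≤ a) (hab : a ≤ b) (h2 : b ≤ 0) :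
    (uturnArc c l r).IsRightCOn a b := by
  refine ⟨?_, ?_⟩
  · filter_upwards [ae_restrict_mem measurableSet_Icc] with s hs
    rw [curvature_uturnArc hc hlr ⟨ha.1.trans hs.1, hs.2.trans hb.2⟩,
      elasticaParam_mem_Icc_neg hc ⟨h1.trans hs.1, hs.2.trans h2⟩]
    have := Real.sin_nonpos_of_nonpos_of_neg_pi_le (hs.2.trans h2) (h1.trans hs.1)
    linarith
  · rw [turning_uturnArc hc hlr ha hb, elasticaParam_mem_Icc_neg hc ⟨h1, hab.trans h2⟩,
      elasticaParam_mem_Icc_neg hc ⟨h1.trans hab, h2⟩, ← elasticaAngle_neg a, ← elasticaAngle_neg b]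
    have e1 := elasticaAngle_mem (t := -a) ⟨by linarith, by linarith⟩
    have e2 := elasticaAngle_mem (t := -b) ⟨by linarith, by linarith⟩
    linarith [e1.2, e2.1]

theorem isLeftCOn_uturnArc (hc : 0 ≤ c) (hlr : l < r) {a b : ℝ} (ha : a ∈ Icc l r)
    (hb : b ∈ Icc l r) (h1 : 0 ≤ a) (hab : a ≤ b) (h2 : b ≤ c + π) :
    (uturnArc c l r).IsLeftCOn a b := by
  refine ⟨?_, ?_⟩
  · filter_upwards [ae_restrict_mem measurableSet_Icc] with s hs
    rw [curvature_uturnArc hc hlr ⟨ha.1.trans hs.1, hs.2.trans hb.2⟩]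
    have := Real.sin_nonneg_of_mem_Icc
      (elasticaParam_mem_Icc (c := c) ⟨h1.trans hs.1, hs.2.trans h2⟩)
    linarith
  · rw [turning_uturnArc hc hlr ha hb]
    have e1 := elasticaAngle_mem (elasticaParam_mem_Icc (c := c) ⟨h1, hab.trans h2⟩)
    have e2 := elasticaAngle_mem (elasticaParam_mem_Icc (c := c) ⟨h1.trans hab, h2⟩)
    linarith [e1.1, e2.2]

theorem isCCurve_uturnArc (hc : 0 ≤ c) (hlr : l < r) (hl : -π ≤ l) (hr : r ≤ 0) :
    IsCCurve (uturnArc c l r) :=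
  ⟨isCurve_uturnArc hc hlr, Or.inr (isRightCOn_uturnArc hc hlr (left_mem_Icc.2 hlr.le)
    (right_mem_Icc.2 hlr.le) hl hlr.le hr)⟩

theorem isSCurve_uturnArc (hc : 0 ≤ c) (hlr : l < r) (hl : -π ≤ l) (hl0 : l < 0)
    (hr : r ≤ c + π) : IsSCurve (uturnArc c l r) := by
  rcases le_or_gt r 0 with h | h
  · exact Or.inl (isCCurve_uturnArc hc hlr hl h)
  · have h0 : (0 : ℝ) ∈ Icc l r := ⟨hl0.le, h.le⟩
    exact Or.inr ⟨isCurve_uturnArc hc hlr, 0, ⟨hl0, h⟩, Or.inr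
      ⟨isRightCOn_uturnArc hc hlr (left_mem_Icc.2 hlr.le) h0 hl hl0.le le_rfl,
      isLeftCOn_uturnArc hc hlr h0 (right_mem_Icc.2 hlr.le) le_rfl h.le hr⟩⟩

theorem vel_div_norm_uturnArc (hc : 0 ≤ c) (hlr : l < r) {s : ℝ} (hs : s ∈ Icc l r) :
    (uturnArc c l r).vel s / (‖(uturnArc c l r).vel s‖ : ℂ) =
      Complex.exp (elasticaAngle (elasticaParam c s) * Complex.I) := by
  rw [vel_uturnArc hc hlr hs, norm_elasticaVel]
  have : (((slowness (elasticaParam c s))⁻¹ : ℝ) : ℂ) ≠ 0 := by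
    exact_mod_cast (inv_pos.2 (slowness_pos _)).ne'
  rw [div_eq_iff this, elasticaVel_eq, mul_comm]

end Arc

/-! ### Optimal elastica -/

/-- Arc length is strictly increasing because the velocity has no zeros, so equal arc lengths mean
equal parameters. -/
theorem IsCurve.equivalent_refl {p : PlanePath} (hp : IsCurve p) : p.Equivalent p := by
  have hi : ∀ s ∈ Icc p.left p.right, ∀ t ∈ Icc p.left p.right,
      IntervalIntegrable (fun x => ‖p.vel x‖) volume s t := fun s hs t ht =>
    (hp.continuousOn_vel.norm.mono (uIcc_subset_Icc hs ht)).intervalIntegrable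
  have hl := left_mem_Icc.2 hp.lt.le
  have hmono : ∀ s ∈ Icc p.left p.right, ∀ t ∈ Icc p.left p.right, s < t →
      p.arcLength s < p.arcLength t := by
    intro s hs t ht hst
    have h1 : p.arcLength t - p.arcLength s = ∫ x in s..t, ‖p.vel x‖ :=
      intervalIntegral.integral_interval_sub_left (hi _ hl t ht) (hi _ hl s hs)
    have h2 := intervalIntegral.intervalIntegral_pos_of_pos_on (hi s hs t ht)
      (fun x hx => norm_pos_iff.2 (hp.ne x ⟨hs.1.trans hx.1.le, hx.2.le.trans ht.2⟩)) hst
    linarith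
  refine ⟨rfl, fun s hs t ht h => ?_⟩
  rcases lt_trichotomy s t with h' | rfl | h'
  · exact absurd h (hmono s hs t ht h').ne
  · rfl
  · exact absurd h (hmono t ht s hs h').ne'

/-- An arc of the elastica with an inserted segment which has the right chord and directions becomes
an s-curve between the given unit tangent vectors. -/
theorem exists_affine_uturnArc {α β γ c l r y : ℝ} (hc : 0 ≤ c) (hlr : l < r) (hl : -π ≤ l)
    (hl0 : l < 0) (hr : r ≤ c + π) (hγ : 0 < -Real.sin γ)
    (hα : elasticaAngle (elasticaParam c l) = α - γ)
    (hβ : elasticaAngle (elasticaParam c r) = β - γ)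
    (hy : xi (elasticaParam c r) - xi (elasticaParam c l) = y) (hy0 : 0 < y)
    (hx : ((Real.sin (elasticaParam c r) + (r - elasticaParam c r)) -
      (Real.sin (elasticaParam c l) + (l - elasticaParam c l))) * -Real.sin γ = y * Real.cos γ) :
    ∃ a b : ℂ, a ≠ 0 ∧ ((uturnArc c l r).map fun z => a * z + b) ∈
        sCurves (UnitTangent.ofAngle 0 α) (UnitTangent.ofAngle 1 β) ∧
      ((uturnArc c l r).map fun z => a * z + b).energy = ENNReal.ofReal (y ^ 2 / -Real.sin γ) := by
  -- The rotation e^{iγ} restores the directions α and β, and k scales a chord of height y to one of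
  -- height -sin γ. The energy y of the arc is divided by k.
  set k : ℝ := -Real.sin γ / y with hk
  have hk0 : 0 < k := div_pos hγ hy0
  set a : ℂ := (k : ℂ) * Complex.exp (γ * Complex.I) with ha
  have hna : ‖a‖ = k := by
    rw [ha, norm_mul, Complex.norm_exp_ofReal_mul_I, mul_one, Complex.norm_real,
      Real.norm_of_nonneg hk0.le]
  have ha0 : a ≠ 0 := by rw [← norm_pos_iff, hna]; exact hk0
  have hk0' : (k : ℂ) ≠ 0 := by exact_mod_cast hk0.ne'
  have hdir : a / (‖a‖ : ℂ) = Complex.exp (γ * Complex.I) := by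
    rw [hna, ha, mul_div_cancel_left₀ _ hk0']
  have hchord : a * ((uturnArc c l r).toFun r - (uturnArc c l r).toFun l) = 1 := by
    have e : ((uturnArc c l r).toFun r - (uturnArc c l r).toFun l) * (-Real.sin γ : ℝ) =
        (y : ℂ) * Complex.exp (-γ * Complex.I) := by
      rw [← Complex.ofReal_neg γ]
      apply Complex.ext
      · rw [Complex.re_mul_ofReal, Complex.re_ofReal_mul, Complex.exp_ofReal_mul_I_re, Real.cos_neg,
          ← hx]
        simp [uturnArc, elastica, -Complex.ofReal_sin]
      · rw [Complex.im_mul_ofReal, Complex.im_ofReal_mul, Complex.exp_ofReal_mul_I_im, Real.sin_neg,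
          ← hy]
        simp [uturnArc, elastica, -Complex.ofReal_sin]
    have hy' : (y : ℂ) ≠ 0 := by exact_mod_cast hy0.ne'
    have h1 : Complex.exp (γ * Complex.I) * Complex.exp (-γ * Complex.I) = 1 := by
      rw [← Complex.exp_add]; simp
    have h2 : (k : ℂ) * y = (-Real.sin γ : ℝ) := by
      rw [hk]; push_cast; field_simp
    have h3 : a * ((uturnArc c l r).toFun r - (uturnArc c l r).toFun l) * y = y := by
      calc a * ((uturnArc c l r).toFun r - (uturnArc c l r).toFun l) * y
          = Complex.exp (γ * Complex.I) * (((uturnArc c l r).toFun r - (uturnArc c l r).toFun l) *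
              ((k : ℂ) * y)) := by rw [ha]; ring
        _ = y * (Complex.exp (γ * Complex.I) * Complex.exp (-γ * Complex.I)) := by
            rw [h2, e]; ring
        _ = y := by rw [h1, mul_one]
    exact mul_right_cancel₀ hy' (h3.trans (one_mul _).symm)
  refine ⟨a, -(a * (uturnArc c l r).toFun l), ha0, ?_, ?_⟩
  · refine map_affine_mem_sCurves ha0
      (u' := ⟨(uturnArc c l r).toFun l, Complex.exp ((α - γ : ℝ) * Complex.I),
        Complex.norm_exp_ofReal_mul_I _⟩)
      (v' := ⟨(uturnArc c l r).toFun r, Complex.exp ((β - γ : ℝ) * Complex.I),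
        Complex.norm_exp_ofReal_mul_I _⟩) ?_ ?_ ?_ ?_
      ⟨isSCurve_uturnArc hc hlr hl hl0 hr, ⟨rfl, ?_⟩, ⟨rfl, ?_⟩⟩
    · simp [UnitTangent.ofAngle]
    · rw [hdir]
      show Complex.exp (α * Complex.I) =
        Complex.exp (γ * Complex.I) * Complex.exp ((α - γ : ℝ) * Complex.I)
      rw [← Complex.exp_add]
      congr 1; push_cast; ring
    · rw [← sub_eq_add_neg, ← mul_sub, hchord]; rfl
    · rw [hdir]
      show Complex.exp (β * Complex.I) =
        Complex.exp (γ * Complex.I) * Complex.exp ((β - γ : ℝ) * Complex.I)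
      rw [← Complex.exp_add]
      congr 1; push_cast; ring
    · rw [← hα]; exact vel_div_norm_uturnArc hc hlr (left_mem_Icc.2 hlr.le)
    · rw [← hβ]; exact vel_div_norm_uturnArc hc hlr (right_mem_Icc.2 hlr.le)
  · rw [energy_map_affine _ _ ha0, energy_uturnArc hc hlr, hy, hna,
      ← ENNReal.ofReal_mul (inv_nonneg.2 hk0.le)]
    congr 1
    rw [hk, inv_div]
    ring

theorem eq_pi_of_elasticaAngle {t : ℝ} (ht : t ∈ Icc 0 π) (h : elasticaAngle t = π) : t = π := by
  by_contra hne
  have hs := sin_elasticaAngle t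
  rw [h, Real.sin_pi] at hs
  rcases ht.1.eq_or_lt with h0 | h0
  · rw [← h0, elasticaAngle_zero] at h
    exact Real.pi_pos.ne h
  · have := Real.sin_pos_of_mem_Ioo ⟨h0, lt_of_le_of_ne ht.2 hne⟩
    nlinarith

/-- The lower bound G is attained by the arc of E through the inflection with end directions α - γ
and β - γ. The sign of σ at a minimizer makes the required segment length nonnegative. -/
theorem exists_optimal_of_isMinOn {α β γ : ℝ} (hα : 0 < α) (hαπ : α < π) (hβ : |β| ≤ α)
    (hσ : 0 ≤ β ∨ 0 ≤ sigma α β β) (hγ : γ ∈ Gam α β)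
    (hmin : IsMinOn (G α β) (Gam α β) γ) :
    ∃ p, IsOptimal (sCurves (UnitTangent.ofAngle 0 α) (UnitTangent.ofAngle 1 β)) p ∧
      p.energy = ENNReal.ofReal (G α β γ) ∧
      ∃ a b : ℂ, a ≠ 0 ∧
        (γ = α - π → ∃ c t : ℝ, 0 ≤ c ∧ t ∈ Icc 0 π ∧
          p = (uturnPath c t).map fun z => a * z + b) ∧
        (α - π < γ → ∃ t₀ t : ℝ, -π < t₀ ∧ t₀ < t ∧ t < π ∧
          p = (elasticaSegment t₀ t).map fun z => a * z + b) := by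
  obtain ⟨b1, b2, b3⟩ := mem_Gam_bounds hγ
  obtain ⟨hβ1, hβ2⟩ := abs_le.1 hβ
  have hy := ySum_pos hα b1 b2 b3
  have hs := neg_sin_pos hα b1 b2
  obtain ⟨hσ0, hσ1⟩ := sigma_of_isMinOn hα hσ hγ hmin
  obtain ⟨t₁, ht₁, hΦ₁, hsin₁, hxi₁⟩ := exists_elasticaAngle_eq (φ := α - γ)
    ⟨by linarith, by linarith⟩
  obtain ⟨t, ht, hΦ, hsin, hxi⟩ := exists_elasticaAngle_eq (φ := β - γ)
    ⟨by linarith, by linarith⟩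
  -- The length c solves (√sin (α - γ) + √sin (β - γ) + c) (-sin γ) = (y₁ + y₂) cos γ, the slope
  -- condition on the chord.
  set c := ySum α β γ * sigma α β γ / -Real.sin γ with hc
  have hc0 : 0 ≤ c := div_nonneg (mul_nonneg hy.le hσ0) hs.le
  have ht₁0 : 0 < t₁ := by
    refine lt_of_le_of_ne ht₁.1 ?_
    rintro rfl
    rw [elasticaAngle_zero] at hΦ₁
    linarith
  have hw₁ : elasticaParam c (-t₁) = -t₁ :=
    elasticaParam_mem_Icc_neg hc0 ⟨by linarith [ht₁.2], by linarith⟩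
  have hw : elasticaParam c (c + t) = t := elasticaParam_add hc0 ht.1
  obtain ⟨a, b, ha, hmem, hen⟩ := exists_affine_uturnArc (α := α) (β := β) (γ := γ)
    (c := c) (l := -t₁) (r := c + t) (y := ySum α β γ) hc0 (by linarith [ht.1])
    (by linarith [ht₁.2]) (by linarith) (by linarith [ht.2]) hs
    (by rw [hw₁, elasticaAngle_neg, hΦ₁]) (by rw [hw, hΦ])
    (by rw [hw, hw₁, xi_neg, hxi, hxi₁, ySum]; ring) hy (by
      rw [hw, hw₁, Real.sin_neg, hsin, hsin₁]
      have e : c * -Real.sin γ = ySum α β γ * sigma α β γ := div_mul_cancel₀ _ hs.ne'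
      have e2 : ySum α β γ * sigma α β γ = ySum α β γ * Real.cos γ +
          Real.sin γ * (√(Real.sin (α - γ)) + √(Real.sin (β - γ))) := by
        unfold sigma
        field_simp
      linarith)
  refine ⟨_, ⟨hmem, by rw [hen]; exact ENNReal.ofReal_ne_top, fun q hq => ?_⟩, hen, a, b, ha, ?_, ?_⟩
  · obtain ⟨γ', hγ', hle⟩ := exists_G_le_energy ⟨hα, hαπ.le⟩ hβ hq
    rw [hen]
    exact (ENNReal.ofReal_le_ofReal (hmin hγ')).trans hle
  · intro h
    have : t₁ = π := eq_pi_of_elasticaAngle ht₁ (by rw [hΦ₁, h]; ring)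
    exact ⟨c, t, hc0, ht, by rw [uturnPath_eq hc0, this]⟩
  · intro h
    have hc' : c = 0 := by rw [hc, hσ1 h, mul_zero, zero_div]
    refine ⟨-t₁, t, neg_lt_neg (lt_of_le_of_ne ht₁.2 ?_), by linarith [ht.1],
      lt_of_le_of_ne ht.2 ?_, by rw [elasticaSegment_eq, hc', zero_add]⟩
    · rintro rfl
      rw [elasticaAngle_pi] at hΦ₁
      linarith
    · rintro rfl
      rw [elasticaAngle_pi] at hΦ
      linarith

/-- In the critical frame the arc of E over [-t₁, -t], which lies before the inflection, fits the
chord without a segment and attains the bound of `critical_le_energy`. -/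
theorem exists_optimal_cCurve {α β : ℝ} (hα : 0 < α) (hαπ : α < π) (hβ : |β| ≤ α)
    (hαβ : α - π < β) (hβ0 : β < 0) (hσ : sigma α β β ≤ 0) :
    ∃ p, IsOptimal (sCurves (UnitTangent.ofAngle 0 α) (UnitTangent.ofAngle 1 β)) p ∧
      IsCCurve p ∧ ∃ a b : ℂ, ∃ t₁ t₂ : ℝ, a ≠ 0 ∧ -π < t₁ ∧ t₁ < t₂ ∧ t₂ ≤ 0 ∧
          p = (elasticaSegment t₁ t₂).map fun z => a * z + b := by
  obtain ⟨γ, hγ, hcrit⟩ := exists_critical hα hαπ hαβ hβ0 (abs_le.1 hβ).1 hσ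
  have hs := neg_sin_pos hα hγ.1.le (hγ.2.trans_lt hβ0)
  have hγ1 := hγ.1
  have hγ2 := hγ.2
  obtain ⟨t₁, ht₁, hΦ₁, hsin₁, hxi₁⟩ := exists_elasticaAngle_eq (φ := α - γ)
    ⟨by linarith, by linarith⟩
  obtain ⟨t, ht, hΦ, hsin, hxi⟩ := exists_elasticaAngle_eq (φ := β - γ)
    ⟨by linarith, by linarith⟩
  have hlt : t < t₁ := by
    by_contra hge
    have := monotoneOn_elasticaAngle ht₁ ht (not_lt.1 hge)
    rw [hΦ, hΦ₁] at this
    linarith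
  have ht₁π : t₁ < π := by
    refine lt_of_le_of_ne ht₁.2 ?_
    rintro rfl
    rw [elasticaAngle_pi] at hΦ₁
    linarith
  have hlr : -t₁ < -t := neg_lt_neg hlt
  have hl : -π ≤ -t₁ := by linarith
  have hr0 : -t ≤ 0 := by linarith [ht.1]
  obtain ⟨a, b, ha, hmem, hen⟩ := exists_affine_uturnArc (α := α) (β := β) (γ := γ)
    (c := 0) (l := -t₁) (r := -t) (y := halfIntegral (α - γ) - halfIntegral (β - γ)) le_rfl hlr
    hl (by linarith) (by linarith [Real.pi_pos]) hs
    (by rw [elasticaParam_zero_left, elasticaAngle_neg, hΦ₁])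
    (by rw [elasticaParam_zero_left, elasticaAngle_neg, hΦ])
    (by rw [elasticaParam_zero_left, elasticaParam_zero_left, xi_neg, xi_neg, hxi, hxi₁]; ring)
    (sub_pos.2 (halfIntegral_lt (by linarith) (by linarith) (by linarith)))
    (by
      rw [elasticaParam_zero_left, elasticaParam_zero_left, Real.sin_neg, Real.sin_neg, hsin, hsin₁,
        hcrit]
      ring)
  refine ⟨_, ⟨hmem, by rw [hen]; exact ENNReal.ofReal_ne_top, fun q hq => ?_⟩,
    (isCCurve_uturnArc le_rfl hlr hl hr0).map_affine b ha,
    a, b, -t₁, -t, ha, by linarith, hlr, hr0, by rw [elasticaSegment_eq]⟩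
  rw [hen]
  exact critical_le_energy ⟨hα, hαπ.le⟩ hβ hβ0 hγ hcrit hq

/-! ### Line segments -/

/-- The real interval `[l, r]` as a path. -/
noncomputable def lineArc (l r : ℝ) : PlanePath := ⟨l, r, fun t => (t : ℂ)⟩

section Line

variable {l r : ℝ}

theorem vel_lineArc (hlr : l < r) {t : ℝ} (ht : t ∈ Icc l r) : (lineArc l r).vel t = 1 :=
  (hasDerivAt_id t).ofReal_comp.hasDerivWithinAt.derivWithin (uniqueDiffOn_Icc hlr t ht)

theorem curvature_lineArc (hlr : l < r) {t : ℝ} (ht : t ∈ Icc l r) :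
    (lineArc l r).curvature t = 0 := by
  have h : derivWithin (lineArc l r).vel (Icc (lineArc l r).left (lineArc l r).right) t = 0 := by
    change derivWithin (lineArc l r).vel (Icc l r) t = 0
    rw [derivWithin_congr (f := fun _ => (1 : ℂ)) (fun x hx => vel_lineArc hlr hx)
      (vel_lineArc hlr ht)]
    simp
  rw [PlanePath.curvature, h]
  simp

theorem isCurve_lineArc (hlr : l < r) : IsCurve (lineArc l r) where
  lt := hlr
  diff := fun t _ => (hasDerivAt_id t).ofReal_comp.differentiableAt.differentiableWithinAt
  ac := by
    refine LipschitzOnWith.absolutelyContinuousOnInterval (K := 0) fun x hx y hy => ?_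
    change x ∈ uIcc l r at hx
    change y ∈ uIcc l r at hy
    rw [uIcc_of_le hlr.le] at hx hy
    rw [vel_lineArc hlr hx, vel_lineArc hlr hy]
    simp
  ne t ht := by rw [vel_lineArc hlr ht]; exact one_ne_zero

theorem energy_lineArc (hlr : l < r) : (lineArc l r).energy = 0 := by
  unfold PlanePath.energy
  rw [setLIntegral_congr_fun (g := fun _ => 0) measurableSet_Icc fun t ht => by
    show ENNReal.ofReal ((lineArc l r).curvature t ^ 2 * _) = _
    rw [curvature_lineArc hlr ht]; simp]
  simp

theorem isCCurve_lineArc (hlr : l < r) : IsCCurve (lineArc l r) := by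
  refine ⟨isCurve_lineArc hlr, Or.inl ⟨?_, ?_⟩⟩
  · filter_upwards [ae_restrict_mem measurableSet_Icc] with t ht
    rw [curvature_lineArc hlr ht]
  · have : (lineArc l r).turning l r = 0 := by
      unfold PlanePath.turning
      rw [intervalIntegral.integral_congr (g := fun _ => (0 : ℝ)) fun t ht => by
        rw [uIcc_of_le hlr.le] at ht
        show (lineArc l r).curvature t * _ = _
        rw [curvature_lineArc hlr ht, zero_mul]]
      simp
    show (lineArc l r).turning l r ≤ π
    rw [this]
    exact Real.pi_pos.le

theorem arcLength_map_lineArc (hlr : l < r) (a b : ℂ) {t : ℝ} (ht : t ∈ Icc l r) :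
    ((lineArc l r).map fun z => a * z + b).arcLength t = ‖a‖ * (t - l) := by
  unfold PlanePath.arcLength
  rw [intervalIntegral.integral_congr (g := fun _ => ‖a‖) fun x hx => by
    have hx' : x ∈ Icc l r := uIcc_subset_Icc (left_mem_Icc.2 hlr.le) ht hx
    show ‖_‖ = _
    rw [vel_map_affine, vel_lineArc hlr hx', mul_one]]
  rw [intervalIntegral.integral_const, smul_eq_mul, mul_comm]
  rfl

theorem similar_unitSegment (hlr : l < r) {a : ℂ} (b : ℂ) (ha : a ≠ 0) :
    ((lineArc l r).map fun z => a * z + b).Similar unitSegment := by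
  have h0 : (r - l : ℝ) ≠ 0 := (sub_pos.2 hlr).ne'
  have h0' : ((r - l : ℝ) : ℂ) ≠ 0 := by exact_mod_cast h0
  have hna : ‖a‖ ≠ 0 := norm_ne_zero_iff.2 ha
  have hn : ‖a * ((r - l : ℝ) : ℂ)‖ = ‖a‖ * (r - l) := by
    rw [norm_mul, Complex.norm_real, Real.norm_of_nonneg (sub_pos.2 hlr).le]
  have hu : ∀ t ∈ Icc (0 : ℝ) 1, (unitSegment.map fun z =>
      a * ((r - l : ℝ) : ℂ) * z + (a * l + b)).arcLength t = ‖a‖ * (r - l) * t := fun t ht => by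
    have := arcLength_map_lineArc (l := 0) (r := 1) one_pos (a * ((r - l : ℝ) : ℂ)) (a * l + b) ht
    rw [hn, sub_zero] at this
    exact this
  refine ⟨a * ((r - l : ℝ) : ℂ), a * l + b, mul_ne_zero ha h0', Or.inl ⟨?_, fun s hs t ht h => ?_⟩⟩
  · have h1 := arcLength_map_lineArc hlr a b (right_mem_Icc.2 hlr.le)
    have h2 := hu 1 (right_mem_Icc.2 zero_le_one)
    rw [mul_one] at h2
    exact h1.trans h2.symm
  · rw [arcLength_map_lineArc hlr a b hs, hu t ht, mul_assoc] at h
    have h1 : s = l + (r - l) * t := by linarith [mul_left_cancel₀ hna h]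
    show a * (s : ℂ) + b = a * ((r - l : ℝ) : ℂ) * (t : ℂ) + (a * l + b)
    rw [h1]
    push_cast
    ring

end Line

theorem unitSegment_optimal :
    IsOptimal (sCurves (UnitTangent.ofAngle 0 0) (UnitTangent.ofAngle 1 0)) unitSegment ∧
      unitSegment.energy = 0 := by
  have hen : unitSegment.energy = 0 := energy_lineArc one_pos
  have hvel : ∀ t ∈ Icc (0 : ℝ) 1, unitSegment.vel t = 1 := fun t ht => vel_lineArc one_pos ht
  refine ⟨⟨⟨Or.inl (isCCurve_lineArc one_pos), ⟨by simp [unitSegment, UnitTangent.ofAngle], ?_⟩,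
    ⟨by simp [unitSegment, UnitTangent.ofAngle], ?_⟩⟩, by simp [hen], fun q _ => by simp [hen]⟩, hen⟩
  · rw [show unitSegment.vel unitSegment.left = 1 from hvel _ (left_mem_Icc.2 zero_le_one)]
    simp [UnitTangent.ofAngle]
  · rw [show unitSegment.vel unitSegment.right = 1 from hvel _ (right_mem_Icc.2 zero_le_one)]
    simp [UnitTangent.ofAngle]

/-! ### Shapes of optimal curves -/

/-- A similarity transformation of the plane. -/
def IsSimilarity (T : ℂ → ℂ) : Prop :=
  ∃ a b : ℂ, a ≠ 0 ∧ ((T = fun z => a * z + b) ∨ T = fun z => a * conj z + b)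

theorem isSimilarity_affine {a : ℂ} (b : ℂ) (ha : a ≠ 0) : IsSimilarity fun z => a * z + b :=
  ⟨a, b, ha, Or.inl rfl⟩

namespace IsSimilarity

variable {T : ℂ → ℂ}

theorem affine_comp (hT : IsSimilarity T) {a : ℂ} (b : ℂ) (ha : a ≠ 0) :
    IsSimilarity fun z => a * T z + b := by
  obtain ⟨a', b', ha', rfl | rfl⟩ := hT
  · exact ⟨a * a', a * b' + b, mul_ne_zero ha ha', Or.inl (by funext z; ring)⟩
  · exact ⟨a * a', a * b' + b, mul_ne_zero ha ha', Or.inr (by funext z; ring)⟩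

theorem conj_comp (hT : IsSimilarity T) : IsSimilarity fun z => conj (T z) := by
  obtain ⟨a', b', ha', rfl | rfl⟩ := hT
  · exact ⟨conj a', conj b', (map_ne_zero _).2 ha', Or.inr (by funext z; simp)⟩
  · exact ⟨conj a', conj b', (map_ne_zero _).2 ha', Or.inl (by funext z; simp)⟩

theorem comp_neg (hT : IsSimilarity T) : IsSimilarity fun z => T (-z) := by
  obtain ⟨a', b', ha', rfl | rfl⟩ := hT
  · exact ⟨-a', b', neg_ne_zero.2 ha', Or.inl (by funext z; ring)⟩
  · exact ⟨-a', b', neg_ne_zero.2 ha', Or.inr (by funext z; simp)⟩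

theorem similar {p q : PlanePath} (hT : IsSimilarity T) (hp : IsCurve p) (h : p = q.map T) :
    p.Similar q := by
  obtain ⟨a, b, ha, rfl | rfl⟩ := hT
  · exact ⟨a, b, ha, Or.inl (by rw [← h]; exact hp.equivalent_refl)⟩
  · exact ⟨a, b, ha, Or.inr (by rw [← h]; exact hp.equivalent_refl)⟩

end IsSimilarity

/-- The images under similarity transformations of line segments, of elastica segments and of
u-turns, the latter possibly reversed. -/
def IsElasticShape (p : PlanePath) : Prop :=
  (∃ (l r : ℝ) (a b : ℂ), l < r ∧ a ≠ 0 ∧ p = (lineArc l r).map fun z => a * z + b) ∨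
  (∃ (t₀ t : ℝ) (T : ℂ → ℂ), -π < t₀ ∧ t₀ < t ∧ t < π ∧ IsSimilarity T ∧
    p = (elasticaSegment t₀ t).map T) ∨
  ∃ (c t : ℝ) (T : ℂ → ℂ), 0 ≤ c ∧ t ∈ Icc 0 π ∧ IsSimilarity T ∧
    (p = (uturnPath c t).map T ∨ p.reverse = (uturnPath c t).map T)

theorem reverse_reverse (p : PlanePath) : p.reverse.reverse = p := by
  simp [PlanePath.reverse]

theorem lineArc_reverse (l r : ℝ) : (lineArc l r).reverse = (lineArc (-r) (-l)).map fun z => -z := by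
  simp [PlanePath.reverse, PlanePath.map, lineArc]

theorem elasticaSegment_reverse (s t : ℝ) :
    (elasticaSegment s t).reverse = (elasticaSegment (-t) (-s)).map fun z => -z := by
  simp [PlanePath.reverse, PlanePath.map, elasticaSegment, elastica_neg]

namespace IsElasticShape

variable {p : PlanePath}

theorem map_affine (hp : IsElasticShape p) {a : ℂ} (b : ℂ) (ha : a ≠ 0) :
    IsElasticShape (p.map fun z => a * z + b) := by
  rcases hp with ⟨l, r, a', b', hlr, ha', rfl⟩ | ⟨t₀, t, T, h1, h2, h3, hT, rfl⟩ |
    ⟨c, t, T, h1, h2, hT, h⟩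
  · refine Or.inl ⟨l, r, a * a', a * b' + b, hlr, mul_ne_zero ha ha', ?_⟩
    simp only [PlanePath.map, mul_add, mul_assoc, add_assoc]
  · exact Or.inr (Or.inl ⟨t₀, t, _, h1, h2, h3, hT.affine_comp b ha, rfl⟩)
  · refine Or.inr (Or.inr ⟨c, t, _, h1, h2, hT.affine_comp b ha, ?_⟩)
    rcases h with rfl | h
    · exact Or.inl rfl
    · refine Or.inr ?_
      change p.reverse.map (fun z => a * z + b) = _
      rw [h]; rfl

theorem map_conj (hp : IsElasticShape p) : IsElasticShape (p.map fun z => conj z) := by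
  rcases hp with ⟨l, r, a', b', hlr, ha', rfl⟩ | ⟨t₀, t, T, h1, h2, h3, hT, rfl⟩ |
    ⟨c, t, T, h1, h2, hT, h⟩
  · refine Or.inl ⟨l, r, conj a', conj b', hlr, (map_ne_zero _).2 ha', ?_⟩
    simp [PlanePath.map, lineArc]
  · exact Or.inr (Or.inl ⟨t₀, t, _, h1, h2, h3, hT.conj_comp, rfl⟩)
  · refine Or.inr (Or.inr ⟨c, t, _, h1, h2, hT.conj_comp, ?_⟩)
    rcases h with rfl | h
    · exact Or.inl rfl
    · refine Or.inr ?_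
      change p.reverse.map (fun z => conj z) = _
      rw [h]; rfl

theorem reverse (hp : IsElasticShape p) : IsElasticShape p.reverse := by
  rcases hp with ⟨l, r, a', b', hlr, ha', rfl⟩ | ⟨t₀, t, T, h1, h2, h3, hT, rfl⟩ |
    ⟨c, t, T, h1, h2, hT, h⟩
  · refine Or.inl ⟨-r, -l, -a', b', neg_lt_neg hlr, neg_ne_zero.2 ha', ?_⟩
    change (lineArc l r).reverse.map (fun z => a' * z + b') = _
    rw [lineArc_reverse]
    simp [PlanePath.map]
  · refine Or.inr (Or.inl ⟨-t, -t₀, _, neg_lt_neg h3, neg_lt_neg h2, by linarith,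
      hT.comp_neg, ?_⟩)
    change (elasticaSegment t₀ t).reverse.map _ = _
    rw [elasticaSegment_reverse]; rfl
  · exact Or.inr (Or.inr ⟨c, t, T, h1, h2, hT, by rw [reverse_reverse]; exact h.symm⟩)

end IsElasticShape

/-! ### Reduction to normalized position -/

/-- If two unit tangent vectors are connected by s-curves, then by an optimal one of elastic
shape. -/
def HasElasticOptimum (u v : UnitTangent) : Prop :=
  (sCurves u v).Nonempty → ∃ p, IsOptimal (sCurves u v) p ∧ IsElasticShape p

/-- The two maps need not be inverse to each other: it suffices that they scale energies by k and by
its inverse. -/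
theorem IsOptimal.transfer {S S' : Set PlanePath} {Ψ Ψ' : PlanePath → PlanePath} {k : ℝ≥0∞}
    (hk0 : k ≠ 0) (hk : k ≠ ∞) (hΨ : ∀ p ∈ S', Ψ p ∈ S ∧ (Ψ p).energy = k * p.energy)
    (hΨ' : ∀ q ∈ S, Ψ' q ∈ S' ∧ (Ψ' q).energy = k⁻¹ * q.energy) {p : PlanePath}
    (hp : IsOptimal S' p) : IsOptimal S (Ψ p) := by
  obtain ⟨h1, h2⟩ := hΨ p hp.1
  refine ⟨h1, by rw [h2]; exact ENNReal.mul_ne_top hk hp.2.1, fun q hq => ?_⟩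
  obtain ⟨h3, h4⟩ := hΨ' q hq
  have h5 := hp.2.2 _ h3
  rw [h4] at h5
  rw [h2]
  calc k * p.energy ≤ k * (k⁻¹ * q.energy) := by gcongr
    _ = q.energy := by rw [← mul_assoc, ENNReal.mul_inv_cancel hk0 hk, one_mul]

theorem HasElasticOptimum.map_affine {u v u' v' : UnitTangent} {a b : ℂ} (ha : a ≠ 0)
    (hu : u.pos = a * u'.pos + b) (hu' : u.dir = a / (‖a‖ : ℂ) * u'.dir)
    (hv : v.pos = a * v'.pos + b) (hv' : v.dir = a / (‖a‖ : ℂ) * v'.dir)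
    (h : HasElasticOptimum u' v') : HasElasticOptimum u v := by
  have hna : 0 < ‖a‖ := norm_pos_iff.2 ha
  have hnc : (‖a‖ : ℂ) ≠ 0 := by exact_mod_cast hna.ne'
  have hback : ∀ q ∈ sCurves u v, (q.map fun z => a⁻¹ * z + -(a⁻¹ * b)) ∈ sCurves u' v' := by
    intro q hq
    refine map_affine_mem_sCurves (inv_ne_zero ha) ?_ ?_ ?_ ?_ hq
    · rw [hu]; field_simp; ring
    · rw [hu', norm_inv]; push_cast; field_simp
    · rw [hv]; field_simp; ring
    · rw [hv', norm_inv]; push_cast; field_simp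
  rintro ⟨q, hq⟩
  obtain ⟨p, hp, hs⟩ := h ⟨_, hback q hq⟩
  refine ⟨_, hp.transfer (Ψ := fun p => p.map fun z => a * z + b)
    (Ψ' := fun q => q.map fun z => a⁻¹ * z + -(a⁻¹ * b)) (k := ENNReal.ofReal ‖a‖⁻¹)
    (ENNReal.ofReal_pos.2 (inv_pos.2 hna)).ne' ENNReal.ofReal_ne_top
    (fun p hp => ⟨map_affine_mem_sCurves ha hu hu' hv hv' hp, energy_map_affine p b ha⟩)
    (fun q hq => ⟨hback q hq, ?_⟩), hs.map_affine b ha⟩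
  rw [energy_map_affine _ _ (inv_ne_zero ha), norm_inv, ENNReal.ofReal_inv_of_pos (inv_pos.2 hna)]

theorem HasElasticOptimum.map_conj {u v u' v' : UnitTangent}
    (hu : u.pos = conj u'.pos) (hu' : u.dir = conj u'.dir)
    (hv : v.pos = conj v'.pos) (hv' : v.dir = conj v'.dir)
    (h : HasElasticOptimum u' v') : HasElasticOptimum u v := by
  have hback : ∀ q ∈ sCurves u v, (q.map fun z => conj z) ∈ sCurves u' v' := fun q hq =>
    map_conj_mem_sCurves (by simp [hu]) (by simp [hu']) (by simp [hv]) (by simp [hv']) hq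
  rintro ⟨q, hq⟩
  obtain ⟨p, hp, hs⟩ := h ⟨_, hback q hq⟩
  exact ⟨_, hp.transfer (Ψ := fun p => p.map fun z => conj z)
    (Ψ' := fun q => q.map fun z => conj z) (k := 1) one_ne_zero ENNReal.one_ne_top
    (fun p hp => ⟨map_conj_mem_sCurves hu hu' hv hv' hp, by rw [energy_map_conj, one_mul]⟩)
    (fun q hq => ⟨hback q hq, by rw [energy_map_conj, inv_one, one_mul]⟩), hs.map_conj⟩

theorem HasElasticOptimum.reverse {u v u' v' : UnitTangent}
    (hu : u.pos = v'.pos) (hu' : u.dir = -v'.dir) (hv : v.pos = u'.pos) (hv' : v.dir = -u'.dir)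
    (h : HasElasticOptimum u' v') : HasElasticOptimum u v := by
  have hback : ∀ q ∈ sCurves u v, q.reverse ∈ sCurves u' v' := fun q hq =>
    reverse_mem_sCurves hv.symm (by simp [hv']) hu.symm (by simp [hu']) hq
  rintro ⟨q, hq⟩
  obtain ⟨p, hp, hs⟩ := h ⟨_, hback q hq⟩
  exact ⟨_, hp.transfer (Ψ := PlanePath.reverse) (Ψ' := PlanePath.reverse) (k := 1)
    one_ne_zero ENNReal.one_ne_top
    (fun p hp => ⟨reverse_mem_sCurves hu hu' hv hv' hp, by rw [energy_reverse, one_mul]⟩)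
    (fun q hq => ⟨hback q hq, by rw [energy_reverse, inv_one, one_mul]⟩), hs.reverse⟩

/-- The two cases are exhaustive even at β = α - π: both roots in σ vanish there, and β ≥ -α forces
α ≥ π / 2, so that σ = cos (α - π) ≥ 0. -/
theorem sigma_nonneg_or {α β : ℝ} (hα : 0 < α) (hαπ : α < π) (hβ : |β| ≤ α) (hαβ : α - π ≤ β) :
    (0 ≤ β ∨ 0 ≤ sigma α β β) ∨ (α - π < β ∧ β < 0 ∧ sigma α β β ≤ 0) := by
  rcases le_or_gt 0 β with h | h
  · exact Or.inl (Or.inl h)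
  rcases le_or_gt 0 (sigma α β β) with h' | h'
  · exact Or.inl (Or.inr h')
  refine Or.inr ⟨lt_of_le_of_ne hαβ ?_, h, h'.le⟩
  rintro rfl
  have h1 := (abs_le.1 hβ).1
  have h2 : 0 ≤ Real.cos (α - π) := Real.cos_nonneg_of_mem_Icc ⟨by linarith, by linarith⟩
  have h3 : sigma α (α - π) (α - π) = Real.cos (α - π) := by
    rw [sigma, sub_sub_cancel, sub_self]; simp
  linarith

theorem hasElasticOptimum_normalized {α β : ℝ} (hα : α ∈ Icc 0 π) (hβ : |β| ≤ α) :
    HasElasticOptimum (UnitTangent.ofAngle 0 α) (UnitTangent.ofAngle 1 β) := by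
  rintro ⟨q, hq⟩
  rcases hα.1.eq_or_lt with h0 | h0
  · subst h0
    obtain rfl : β = 0 := abs_nonpos_iff.1 hβ
    refine ⟨unitSegment, unitSegment_optimal.1, Or.inl ⟨0, 1, 1, 0, one_pos, one_ne_zero, ?_⟩⟩
    simp [unitSegment, lineArc, PlanePath.map]
  obtain ⟨hαπ, hαβ, -⟩ := directions_of_mem_sCurves ⟨h0, hα.2⟩ hβ hq
  rcases sigma_nonneg_or h0 hαπ hβ hαβ with h | ⟨h1, h2, h3⟩
  · obtain ⟨γ, hγ, hmin⟩ := exists_isMinOn_G h0 hαπ hαβ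
    obtain ⟨p, hp, -, a, b, ha, h1, h2⟩ := exists_optimal_of_isMinOn h0 hαπ hβ h hγ hmin
    refine ⟨p, hp, Or.inr ?_⟩
    rcases (mem_Gam_bounds hγ).1.eq_or_lt with h' | h'
    · obtain ⟨c, t, hc, ht, rfl⟩ := h1 h'.symm
      exact Or.inr ⟨c, t, _, hc, ht, isSimilarity_affine b ha, Or.inl rfl⟩
    · obtain ⟨t₀, t, e1, e2, e3, rfl⟩ := h2 h'
      exact Or.inl ⟨t₀, t, _, e1, e2, e3, isSimilarity_affine b ha, rfl⟩
  · obtain ⟨p, hp, -, a, b, t₁, t₂, ha, e1, e2, e3, rfl⟩ :=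
      exists_optimal_cCurve h0 hαπ hβ h1 h2 h3
    exact ⟨_, hp, Or.inr (Or.inl ⟨t₁, t₂, _, e1, e2, by linarith [Real.pi_pos],
      isSimilarity_affine b ha, rfl⟩)⟩

/-- Reflection in the real axis makes α nonnegative, and reversal exchanges the two angles when |β|
> |α|. -/
theorem hasElasticOptimum_ofAngle {α β : ℝ} (hα : |α| ≤ π) (hβ : |β| ≤ π) :
    HasElasticOptimum (UnitTangent.ofAngle 0 α) (UnitTangent.ofAngle 1 β) := by
  have conj_exp : ∀ x : ℝ, Complex.exp (x * Complex.I) = conj (Complex.exp ((-x : ℝ) * Complex.I)) := by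
    intro x
    rw [← Complex.exp_conj, map_mul, Complex.conj_I, Complex.conj_ofReal]
    push_cast
    ring_nf
  have main : ∀ α β : ℝ, |α| ≤ π → |β| ≤ |α| →
      HasElasticOptimum (UnitTangent.ofAngle 0 α) (UnitTangent.ofAngle 1 β) := by
    intro α β hα hβ
    rcases le_total 0 α with h | h
    · rw [abs_of_nonneg h] at hα hβ
      exact hasElasticOptimum_normalized ⟨h, hα⟩ hβ
    · rw [abs_of_nonpos h] at hα hβ
      refine HasElasticOptimum.map_conj ?_ ?_ ?_ ?_
        (hasElasticOptimum_normalized (α := -α) (β := -β) ⟨neg_nonneg.2 h, hα⟩ (by rwa [abs_neg]))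
      · simp [UnitTangent.ofAngle]
      · exact conj_exp α
      · simp [UnitTangent.ofAngle]
      · exact conj_exp β
  rcases le_total |β| |α| with h | h
  · exact main α β hα h
  -- Reversal exchanges the end points and negates the directions; the half turn z ↦ 1 - z undoes
  -- both, leaving α and β exchanged.
  · refine HasElasticOptimum.map_affine (a := -1) (b := 1)
      (u' := ⟨1, -Complex.exp (α * Complex.I), by rw [norm_neg, Complex.norm_exp_ofReal_mul_I]⟩)
      (v' := ⟨0, -Complex.exp (β * Complex.I), by rw [norm_neg, Complex.norm_exp_ofReal_mul_I]⟩)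
      (by simp) ?_ ?_ ?_ ?_
      (HasElasticOptimum.reverse ?_ ?_ ?_ ?_ (main β α hβ h)) <;> simp [UnitTangent.ofAngle]

theorem hasElasticOptimum {u v : UnitTangent} (huv : u.pos ≠ v.pos) : HasElasticOptimum u v := by
  set d := v.pos - u.pos with hd
  have hd0 : d ≠ 0 := sub_ne_zero.2 huv.symm
  have hnd : (‖d‖ : ℂ) ≠ 0 := by exact_mod_cast norm_ne_zero_iff.2 hd0
  have hdir : ∀ w : ℂ, ‖w‖ = 1 →
      w = d / (‖d‖ : ℂ) * Complex.exp ((w * (‖d‖ : ℂ) / d).arg * Complex.I) := by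
    intro w hw
    have hn : ‖w * (‖d‖ : ℂ) / d‖ = 1 := by
      rw [norm_div, norm_mul, hw, Complex.norm_real, norm_norm, one_mul,
        div_self (norm_ne_zero_iff.2 hd0)]
    have := Complex.norm_mul_exp_arg_mul_I (w * (‖d‖ : ℂ) / d)
    rw [hn, Complex.ofReal_one, one_mul] at this
    rw [this]
    field_simp
  refine HasElasticOptimum.map_affine hd0 (b := u.pos) ?_ (hdir _ u.norm_dir) ?_
    (hdir _ v.norm_dir) (hasElasticOptimum_ofAngle (Complex.abs_arg_le_pi _)
      (Complex.abs_arg_le_pi _))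
  · simp [UnitTangent.ofAngle]
  · simp [UnitTangent.ofAngle, hd]

end ElasticSpline

open ElasticSpline
theorem theorem5p1 :
    -- existence, and the shape of an optimal curve, for arbitrary unit tangent vectors
    (∀ u v : UnitTangent, u.pos ≠ v.pos → (sCurves u v).Nonempty →
      ∃ p, IsOptimal (sCurves u v) p ∧
        (p.Similar unitSegment ∨
         (∃ t₀ t : ℝ, -Real.pi < t₀ ∧ t₀ < t ∧ t < Real.pi ∧ p.Similar (elasticaSegment t₀ t)) ∨
         (∃ c t : ℝ, 0 ≤ c ∧ t ∈ Set.Icc 0 Real.pi ∧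
           (p.Similar (uturnPath c t) ∨ p.reverse.Similar (uturnPath c t))))) ∧
    -- the normalized position, to which every pair is reduced by a similarity and a reversal
    (∀ α β : ℝ, α ∈ Set.Icc 0 Real.pi → |β| ≤ α →
      ∀ S : Set PlanePath,
        S = sCurves (UnitTangent.ofAngle 0 α) (UnitTangent.ofAngle 1 β) →
        (S.Nonempty ↔ α < Real.pi ∧ α - Real.pi ≤ β) ∧
        (α = 0 → IsOptimal S unitSegment ∧ unitSegment.energy = 0) ∧
        (0 < α → α < Real.pi → α - Real.pi ≤ β →
          -- the cases in which the minimum is the minimum of `G`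
          ((0 ≤ β ∨ 0 ≤ sigma α β β) →
            (∃ γ ∈ Gam α β, IsMinOn (G α β) (Gam α β) γ) ∧
            ∀ γ ∈ Gam α β, IsMinOn (G α β) (Gam α β) γ →
              ∃ p, IsOptimal S p ∧ p.energy = ENNReal.ofReal (G α β γ) ∧
                (γ = α - Real.pi → IsSecondForm p) ∧ (α - Real.pi < γ → IsFirstForm p)) ∧
          -- the remaining case: the optimal curve is a c-curve of first form
          (α - Real.pi < β → β < 0 → sigma α β β ≤ 0 →
            ∃ p, IsOptimal S p ∧ IsCCurve p ∧
              ∃ t₁ t₂ : ℝ, -Real.pi < t₁ ∧ t₁ < t₂ ∧ t₂ ≤ 0 ∧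
                p.DirectlySimilar (elasticaSegment t₁ t₂)))) := by
  refine ⟨fun u v huv hne => ?_, ?_⟩
  · obtain ⟨p, hp, hs⟩ := hasElasticOptimum huv hne
    have hc := hp.1.1.isCurve
    refine ⟨p, hp, ?_⟩
    rcases hs with ⟨l, r, a, b, hlr, ha, rfl⟩ | ⟨t₀, t, T, h1, h2, h3, hT, h⟩ |
      ⟨c, t, T, h1, h2, hT, h⟩
    · exact Or.inl (similar_unitSegment hlr b ha)
    · exact Or.inr (Or.inl ⟨t₀, t, h1, h2, h3, hT.similar hc h⟩)
    · exact Or.inr (Or.inr ⟨c, t, h1, h2, h.imp (hT.similar hc) (hT.similar hc.reverse)⟩)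
  · rintro α β hα hβ S rfl
    refine ⟨⟨?_, ?_⟩, ?_, ?_⟩
    · rintro ⟨q, hq⟩
      rcases hα.1.eq_or_lt with h0 | h0
      · subst h0
        obtain rfl : β = 0 := abs_nonpos_iff.1 hβ
        exact ⟨Real.pi_pos, by linarith [Real.pi_pos]⟩
      · obtain ⟨h1, h2, -⟩ := directions_of_mem_sCurves ⟨h0, hα.2⟩ hβ hq
        exact ⟨h1, h2⟩
    · rintro ⟨hαπ, hαβ⟩
      rcases hα.1.eq_or_lt with h0 | h0
      · subst h0
        obtain rfl : β = 0 := abs_nonpos_iff.1 hβ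
        exact ⟨_, unitSegment_optimal.1.1⟩
      · rcases sigma_nonneg_or h0 hαπ hβ hαβ with h | ⟨h1, h2, h3⟩
        · obtain ⟨γ, hγ, hmin⟩ := exists_isMinOn_G h0 hαπ hαβ
          obtain ⟨p, hp, -⟩ := exists_optimal_of_isMinOn h0 hαπ hβ h hγ hmin
          exact ⟨p, hp.1⟩
        · obtain ⟨p, hp, -⟩ := exists_optimal_cCurve h0 hαπ hβ h1 h2 h3
          exact ⟨p, hp.1⟩
    · rintro rfl
      obtain rfl : β = 0 := abs_nonpos_iff.1 hβ
      exact unitSegment_optimal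
    · intro h0 hαπ hαβ
      refine ⟨fun hσ => ⟨exists_isMinOn_G h0 hαπ hαβ, fun γ hγ hmin => ?_⟩, fun h1 h2 h3 => ?_⟩
      · obtain ⟨p, hp, hen, a, b, ha, h1, h2⟩ := exists_optimal_of_isMinOn h0 hαπ hβ hσ hγ hmin
        have hc := hp.1.1.isCurve
        refine ⟨p, hp, hen, fun h => ?_, fun h => ?_⟩
        · obtain ⟨c, t, hc0, ht, he⟩ := h1 h
          exact ⟨c, t, hc0, ht, a, b, ha, by rw [← he]; exact hc.equivalent_refl⟩
        · obtain ⟨t₀, t, e1, e2, e3, he⟩ := h2 h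
          exact ⟨t₀, t, e1, e2, e3, a, b, ha, by rw [← he]; exact hc.equivalent_refl⟩
      · obtain ⟨p, hp, hcc, a, b, t₁, t₂, ha, e1, e2, e3, he⟩ :=
          exists_optimal_cCurve h0 hαπ hβ h1 h2 h3
        exact ⟨p, hp, hcc, t₁, t₂, e1, e2, e3, a, b, ha, by rw [← he]; exact hcc.1.equivalent_refl⟩
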